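/- Let $N\ge k\ge 1$ be integers and let $\epsilon>0$ satisfy $2.3766\cdot\epsilon N<1$. There are $N$ agents (senders) and a principal. Let $V\subset[0,1]$ be a finite set of values. The values $v_1,\dots,v_N$ are independent, and agent $i$'s value has a prior distribution on $V$ with $\Pr[v_i=v]=t_{iv}\,\epsilon$, where each $t_{iv}$ is a nonnegative integer. Each agent $i$ has a nonnegative, nondecreasing utility function $u_i$ on $[0,1]$ with $u_i(v)>0$ for $v>0$. A (pure) strategy of agent $i$ is a discretized signaling scheme: a finite set of signals together with conditional probabilities $\pi_i(\sigma\mid v)$ that are multiples of $1/t_{iv}$ whenever $t_{iv}\ge1$. In other words, each signal is formed from integer multiples of $\epsilon$ of the mass on each value. Schemes that differ only by relabelling signals or by signals of probability zero are not distinguished; accordingly, all signals are taken from a fixed finite label set with at least $1/\epsilon$ elements. Given the schemes and the independently drawn signals, the principal computes the posterior means $e_i=\mathbb E[v_i\mid\sigma_i]$ and selects the $k$ agents with the highest posterior means, breaking ties uniformly at random. If $\rho_i$ is the resulting probability that $i$ is selected, then agent $i$'s expected payoff is $\mathbb E\big[\rho_i\cdot\mathbb E[u_i(v_i)\mid\sigma_i]\big]$,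 and the welfare $\mathrm{SW}$ is the expected sum of the $k$ highest posterior means. Agents may independently mix over their finitely many schemes; the realized schemes are known to the principal, and payoffs and welfare are the expectations of those of the pure profiles. A Nash equilibrium is a profile of mixed strategies in which no agent can increase her expected payoff by deviating unilaterally. Then a Nash equilibrium exists, and the price of anarchy satisfies $$\mathrm{PoA}=\frac{\mathbb E\big[\max_{A\subseteq\{1,\dots,N\},\,|A|=k}\sum_{i\in A}v_i\big]}{\inf_{\text{Nash equilibria}}\mathrm{SW}}\;\le\;\frac{22.459}{1-2.3766\cdot\epsilon N}$$ (with $0/0=0$, and $a/0=\infty$ for $a>0$). -/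

import Mathlib

open scoped BigOperators ENNReal

noncomputable section

namespace Persuasion

/-- An instance with `N` agents whose priors have masses that are multiples of `ε`.
`V` is the finite set of possible values, `t i v * ε` is the probability that agent `i` has
value `v`, and `u i v` is the utility of agent `i` when she is selected with value `v`. -/
structure Game (N : ℕ) (ε : ℝ) where
  V : Finset ℝ
  V_subset : ∀ v ∈ V, v ∈ Set.Icc (0 : ℝ) 1
  t : Fin N → V → ℕ
  total_mass : ∀ i, ∑ v, (t i v : ℝ) * ε = 1
  u : Fin N → ℝ → ℝ
  u_nonneg : ∀ i, ∀ v ∈ Set.Icc (0 : ℝ) 1, 0 ≤ u i v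
  u_mono : ∀ i, MonotoneOn (u i) (Set.Icc (0 : ℝ) 1)
  u_pos : ∀ i, ∀ v ∈ Set.Ioc (0 : ℝ) 1, 0 < u i v

/-- The `j`-th largest entry (`1 ≤ j ≤ N`) of the vector `e`, counted with multiplicity;
`0` for `j` outside this range is never used. -/
def ordered {N : ℕ} (e : Fin N → ℝ) (j : ℕ) : ℝ :=
  if h : j - 1 < N then e (Tuple.sort (fun i => - e i) ⟨j - 1, h⟩) else 0

/-- Agents that are selected without a tie, when the posterior means are `e`. -/
def winners {N : ℕ} (k : ℕ) (e : Fin N → ℝ) : Finset (Fin N) :=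
  {i | e i > ordered e k}

/-- Agents whose posterior mean equals the `k`-th largest one. -/
def tied {N : ℕ} (k : ℕ) (e : Fin N → ℝ) : Finset (Fin N) :=
  {i | e i = ordered e k}

/-- Probability that agent `i` is selected when the principal selects the `k` agents with the
highest posterior means `e` and breaks ties uniformly at random. -/
def selectProb {N : ℕ} (k : ℕ) (e : Fin N → ℝ) (i : Fin N) : ℝ :=
  if i ∈ winners k e then 1
  else if i ∈ tied k e then ((k : ℝ) - (winners k e).card) / (tied k e).card
  else 0

namespace Game

variable {N : ℕ} {ε : ℝ} (G : Game N ε)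

/-- `Pr[v_i = v]`. -/
def prior (i : Fin N) (v : G.V) : ℝ := (G.t i v : ℝ) * ε

/-- First-best welfare: the expectation of the largest total value of `k` agents. -/
def firstBest (k : ℕ) : ℝ :=
  ∑ v : Fin N → G.V, (∏ i, G.prior i (v i)) *
    ⨆ A : {A : Finset (Fin N) // A.card = k}, ∑ i ∈ A.1, ((v i : G.V) : ℝ)

/-- A discretized signaling scheme of agent `i` with signals labelled by `S`: the signal `s`
receives `mass s v` of the `t i v` units (of size `ε`) of prior mass at the value `v`. -/
structure Scheme (S : Type*) [Fintype S] (i : Fin N) where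
  mass : S → G.V → ℕ
  sum_mass : ∀ v, ∑ s, mass s v = G.t i v

variable {S : Type*} [Fintype S]

instance (i : Fin N) : Finite (G.Scheme S i) := by
  have hle : ∀ (z : G.Scheme S i) s v, z.mass s v < G.t i v + 1 := fun z s v => by
    have h := Finset.single_le_sum (f := fun s => z.mass s v) (fun _ _ => Nat.zero_le _)
      (Finset.mem_univ s)
    have h' := z.sum_mass v
    omega
  refine Finite.of_injective
    (fun z : G.Scheme S i => fun (s : S) (v : G.V) => (⟨z.mass s v, hle z s v⟩ : Fin (G.t i v + 1)))
    ?_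
  rintro ⟨a, ha⟩ ⟨b, hb⟩ h
  have : a = b := by
    funext s v
    have := congrFun (congrFun h s) v
    simpa using this
  subst this
  rfl

instance (i : Fin N) : Fintype (G.Scheme S i) := Fintype.ofFinite _

variable {G}

/-- The conditional probability that `s` is sent given the value `v`, a multiple of `1 / t i v`
(irrelevant, and set to `0`, at values that have probability `0`). -/
def Scheme.kernel {i : Fin N} (z : G.Scheme S i) (s : S) (v : G.V) : ℝ :=
  (z.mass s v : ℝ) / (G.t i v : ℝ)

/-- The probability that the signal `s` is sent. -/
def Scheme.signalProb {i : Fin N} (z : G.Scheme S i) (s : S) : ℝ :=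
  ∑ v, z.kernel s v * G.prior i v

/-- The conditional expectation `E[f(v_i) | s]` (used only for signals of positive probability). -/
def Scheme.condExp {i : Fin N} (z : G.Scheme S i) (f : ℝ → ℝ) (s : S) : ℝ :=
  (∑ v : G.V, f (v : ℝ) * (z.kernel s v * G.prior i v)) / ∑ v, z.kernel s v * G.prior i v

/-- The posterior mean of the value given the signal `s`. -/
def Scheme.postMean {i : Fin N} (z : G.Scheme S i) (s : S) : ℝ := z.condExp (fun v => v) s

/-- Expected utility of agent `i` under a profile of (pure) signaling schemes. -/
def pureUtility (k : ℕ) (Z : ∀ i, G.Scheme S i) (i : Fin N) : ℝ :=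
  ∑ s : Fin N → S, (∏ j, (Z j).signalProb (s j)) *
    (selectProb k (fun j => (Z j).postMean (s j)) i * (Z i).condExp (G.u i) (s i))

/-- Expected welfare under a profile of (pure) signaling schemes: the expected sum of the `k`
highest posterior means. -/
def pureWelfare (k : ℕ) (Z : ∀ i, G.Scheme S i) : ℝ :=
  ∑ s : Fin N → S, (∏ j, (Z j).signalProb (s j)) *
    ∑ j ∈ Finset.Icc 1 k, ordered (fun i => (Z i).postMean (s i)) j

variable (G S)

/-- Profiles of mixed strategies: each agent independently randomizes over her schemes. -/
abbrev MixedProfile := ∀ i, stdSimplex ℝ (G.Scheme S i)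

variable {G S}

/-- Expectation over the independent choice of the schemes. The realized schemes (not only the
mixtures) are known to the principal, so payoffs are averages of those of the pure profiles. -/
def mixedExp (x : G.MixedProfile S) (f : (∀ i, G.Scheme S i) → ℝ) : ℝ :=
  ∑ Z : ∀ i, G.Scheme S i, (∏ j, (x j : G.Scheme S j → ℝ) (Z j)) * f Z

def utility (k : ℕ) (x : G.MixedProfile S) (i : Fin N) : ℝ :=
  mixedExp x fun Z => pureUtility k Z i

def welfare (k : ℕ) (x : G.MixedProfile S) : ℝ :=
  mixedExp x (pureWelfare k)

/-- Nash equilibrium (in mixed strategies) of the discretized game. -/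
def IsNash (k : ℕ) (x : G.MixedProfile S) : Prop :=
  ∀ (i : Fin N) (y : stdSimplex ℝ (G.Scheme S i)),
    utility k (Function.update x i y) i ≤ utility k x i

variable (G S)

/-- Price of anarchy: first-best welfare over the infimum of the welfare in equilibria. In
`ℝ≥0∞` a positive number divided by `0` is `∞`, and `0 / 0 = 0`. -/
def PoA (k : ℕ) : ℝ≥0∞ :=
  ENNReal.ofReal (G.firstBest k) /
    ⨅ x : {x : G.MixedProfile S // IsNash k x}, ENNReal.ofReal (welfare k x.1)

end Game

end Persuasion

end

/-! Existence and the welfare bound are independent.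

Existence is Nash's theorem for finite games (`exists_mixed_nash`), obtained combinatorially. A
parity count of rooms and doors gives Scarf's lemma (`Scarf.exists_colorful`). Applied to finer and
finer nets, it yields a closed covering theorem for the simplex
(`Scarf.exists_mem_of_closed_cover`). This is used on the simplex over all pure strategies of all
players, covered by the sets where a given strategy is a best reply.

For the bound, fix an equilibrium of welfare `W` and a threshold `T` with `k * T` slightly above `2
* W`. Let `α` be the probability that fewer than `k` competitors of an agent reach posterior mean
`T`. When `k` of them do, the realized welfare is at least `k * T`, so `α ≥ 1/2`. A signal of mean
at least `T` wins with probability at least `α`, one of mean below `T` with probability at most `α`.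
An agent could pool her best units from low signals into one signal of mean at least `T`. As this
does not pay and utilities are monotone, the pool is no larger than the mass on which she already
wins, divided by `α` (`prefix_dichotomy`, with a separate case of zero utility). Hence the expected
excess of her value over `T` is at most `ε * T`, for one unit of rounding, plus twice the
expectation of `v + T` on the event that she is selected (`Scheme.sum_excess_le`).

Over all agents this sums to `N * ε * T + 2 * (W + k * T)`, because `k` agents are selected. The
first best is at most `k * T` plus the total excess, which gives the factor `8 + 2 * ε * N`. Under
the hypothesis on `ε * N` this is below 9. -/

/-! ### Scarf's combinatorial lemma -/

namespace Scarf

variable {ι Y α : Type*} [LinearOrder α]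

/-- No element of `Y` beats, in every one of the orders given by `key`, the minimum of `B`. -/
def Dominant (key : ι → Y → α) (B : Finset Y) : Prop :=
  ∀ y, ∃ i, ∀ b ∈ B, key i y ≤ key i b

lemma Dominant.mono {key : ι → Y → α} {B B' : Finset Y} (h : Dominant key B) (hB : B' ⊆ B) :
    Dominant key B' := fun y => by
  obtain ⟨i, hi⟩ := h y
  exact ⟨i, fun b hb => hi b (hB hb)⟩

/-- `x` is the largest element in the order `d` among those exceeding `m e` in all other orders. -/
def IsTop (key : ι → Y → α) (m : ι → Y) (d : ι) (x : Y) : Prop :=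
  (∀ e, e ≠ d → key e (m e) < key e x) ∧
    ∀ y, (∀ e, e ≠ d → key e (m e) < key e y) → key d y ≤ key d x

lemma exists_isTop [Finite Y] (key : ι → Y → α) (m : ι → Y) (d : ι) {y : Y}
    (hy : ∀ e, e ≠ d → key e (m e) < key e y) : ∃ x, IsTop key m d x := by
  obtain ⟨x, hx, hmax⟩ := Set.exists_max_image {y | ∀ e, e ≠ d → key e (m e) < key e y} (key d)
    (Set.toFinite _) ⟨y, hy⟩
  exact ⟨x, hx, hmax⟩

variable {key : ι → Y → α} {m : ι → Y} {τ : Finset Y} {i j d : ι} {x y : Y}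

lemma IsTop.unique (hinj : ∀ i, Function.Injective (key i)) (hx : IsTop key m d x)
    (hy : IsTop key m d y) : x = y :=
  hinj d (le_antisymm (hy.2 x hx.1) (hx.2 y hy.1))

/-- An element that is top for two orders would exceed the minimum of `τ` in every order, against
dominance. -/
lemma IsTop.ne (hτ : Dominant key τ) (hm : ∀ i, m i ∈ τ) (hij : i ≠ j)
    (hx : IsTop key m i x) (hy : IsTop key m j y) : x ≠ y := by
  rintro rfl
  obtain ⟨e, he⟩ := hτ x
  by_cases h : e = i
  · exact absurd (he _ (hm e)) (not_le.2 (hy.1 e (h ▸ hij)))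
  · exact absurd (he _ (hm e)) (not_le.2 (hx.1 e h))

lemma IsTop.le (hτ : Dominant key τ) (hm : ∀ i, m i ∈ τ) (hx : IsTop key m d x) :
    ∀ b ∈ τ, key d x ≤ key d b := by
  obtain ⟨e, he⟩ := hτ x
  by_cases h : e = d
  · exact h ▸ he
  · exact absurd (he _ (hm e)) (not_le.2 (hx.1 e h))

lemma IsTop.notMem (hinj : ∀ i, Function.Injective (key i)) (hτ : Dominant key τ)
    (hm : ∀ i, m i ∈ τ) (hmle : ∀ i, ∀ b ∈ τ, key i (m i) ≤ key i b)
    (hij : i ≠ j) (hmij : m i = m j) (hx : IsTop key m i x) : x ∉ τ := by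
  intro hxτ
  have h : x = m i := hinj i (le_antisymm (hx.le hτ hm _ (hm i)) (hmle i x hxτ))
  have := hx.1 j hij.symm
  rw [h, hmij] at this
  exact lt_irrefl _ this

lemma IsTop.dominant [DecidableEq Y] (hτ : Dominant key τ) (hm : ∀ i, m i ∈ τ)
    (hmle : ∀ i, ∀ b ∈ τ, key i (m i) ≤ key i b) (hx : IsTop key m d x) :
    Dominant key (insert x τ) := by
  intro y
  by_contra! hcon
  have hy : ∀ e, e ≠ d → key e (m e) < key e y := by
    intro e he
    obtain ⟨b, hb, hlt⟩ := hcon e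
    rcases Finset.mem_insert.1 hb with rfl | hb
    · exact (hx.1 e he).trans hlt
    · exact (hmle e b hb).trans_lt hlt
  obtain ⟨b, hb, hlt⟩ := hcon d
  have hyx := hx.2 y hy
  rcases Finset.mem_insert.1 hb with rfl | hb
  · exact absurd hyx (not_le.2 hlt)
  · exact absurd (hyx.trans (hx.le hτ hm b hb)) (not_le.2 hlt)

/-- Dominance gives each element of `insert x τ` an order in which it is minimal; by counting, this
is a bijection. Each old element is then the minimum of `τ` in its order, so `x` must take one of
the two orders that share a minimum. -/
lemma isTop_of_dominant_insert [DecidableEq Y] [Fintype ι] (hinj : ∀ i, Function.Injective (key i))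
    (hm : ∀ i, m i ∈ τ) (hmle : ∀ i, ∀ b ∈ τ, key i (m i) ≤ key i b)
    (hcard : τ.card + 1 = Fintype.card ι) (hij : i ≠ j) (hmij : m i = m j) (hx : x ∉ τ)
    (hdom : Dominant key (insert x τ)) : IsTop key m i x ∨ IsTop key m j x := by
  choose g hg using fun z : {z // z ∈ insert x τ} => hdom z
  have hginj : Function.Injective g := fun z z' h => Subtype.ext <|
    hinj (g z) (le_antisymm (hg z _ z'.2) (h ▸ hg z' _ z.2))
  have hgbij : Function.Bijective g := by
    refine (Fintype.bijective_iff_injective_and_card g).2 ⟨hginj, ?_⟩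
    rw [Fintype.card_coe, Finset.card_insert_of_notMem hx, hcard]
  have hxm : x ∈ insert x τ := Finset.mem_insert_self _ _
  have hother : ∀ z : {z // z ∈ insert x τ}, z.1 ≠ x → m (g z) = z.1 := by
    intro z hz
    have hzτ : z.1 ∈ τ := (Finset.mem_insert.1 z.2).resolve_left hz
    exact hinj (g z) (le_antisymm (hmle _ _ hzτ) (hg z _ (Finset.mem_insert_of_mem (hm _))))
  set d := g ⟨x, hxm⟩ with hd
  have hne : ∀ e, e ≠ d → ∃ z : {z // z ∈ insert x τ}, g z = e ∧ z.1 ≠ x := by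
    intro e he
    obtain ⟨z, rfl⟩ := hgbij.2 e
    exact ⟨z, rfl, fun h => he (by rw [hd]; congr 1; exact Subtype.ext h)⟩
  have htop : IsTop key m d x := by
    refine ⟨fun e he => ?_, fun y hy => ?_⟩
    · obtain ⟨z, rfl, hzx⟩ := hne e he
      rw [hother z hzx]
      exact lt_of_le_of_ne (hg z _ hxm) fun h => hzx (hinj _ h)
    · obtain ⟨e, he⟩ := hdom y
      by_cases h : e = d
      · exact h ▸ he x hxm
      · exact absurd (he _ (Finset.mem_insert_of_mem (hm e))) (not_le.2 (hy e h))
  by_cases hi : i = d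
  · exact Or.inl (hi ▸ htop)
  by_cases hj : j = d
  · exact Or.inr (hj ▸ htop)
  obtain ⟨z, hz, hzx⟩ := hne i hi
  obtain ⟨z', hz', hzx'⟩ := hne j hj
  refine absurd ?_ hij
  have h1 := hother z hzx
  have h2 := hother z' hzx'
  rw [hz] at h1
  rw [hz'] at h2
  rw [← hz, ← hz', Subtype.ext (h1.symm.trans (hmij.trans h2))]

open Classical in
/-- The dominant sets with as many elements as there are orders that contain `τ`. -/
noncomputable def rooms [Fintype ι] [Fintype Y] (key : ι → Y → α) (τ : Finset Y) :
    Finset (Finset Y) :=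
  {B | B.card = Fintype.card ι ∧ Dominant key B ∧ τ ⊆ B}

lemma mem_rooms_iff [Fintype ι] [Fintype Y] [DecidableEq Y]
    (hcard : τ.card + 1 = Fintype.card ι) {B : Finset Y} :
    B ∈ rooms key τ ↔ ∃ x, x ∉ τ ∧ B = insert x τ ∧ Dominant key (insert x τ) := by
  simp only [rooms, Finset.mem_filter, Finset.mem_univ, true_and]
  constructor
  · rintro ⟨hB, hd, hs⟩
    have h1 : (B \ τ).card = 1 := by
      rw [Finset.card_sdiff_of_subset hs]; omega
    obtain ⟨x, hx⟩ := Finset.card_eq_one.1 h1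
    have hxB : x ∈ B \ τ := hx ▸ Finset.mem_singleton_self x
    have hBx : B = insert x τ := by
      rw [← Finset.sdiff_union_of_subset hs, hx, Finset.insert_eq]
    exact ⟨x, (Finset.mem_sdiff.1 hxB).2, hBx, hBx ▸ hd⟩
  · rintro ⟨x, hx, rfl, hd⟩
    exact ⟨by rw [Finset.card_insert_of_notMem hx, hcard], hd, Finset.subset_insert _ _⟩

/-- The elements `s i` form slack: `s i` is least in the order `i`, and exceeds every element that
is not slack in the other orders. -/
structure IsSlack (key : ι → Y → α) (s : ι → Y) : Prop where
  lt : ∀ i y, y ≠ s i → key i (s i) < key i y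
  lt_slack : ∀ i j y, j ≠ i → y ∉ Set.range s → key i y < key i (s j)

lemma IsSlack.injective {s : ι → Y} (hs : IsSlack key s) {y₀ : Y} (hy₀ : y₀ ∉ Set.range s) :
    Function.Injective s := by
  intro i j h
  by_contra hij
  have h1 := hs.lt_slack i j y₀ (Ne.symm hij) hy₀
  rw [← h] at h1
  exact absurd h1 (not_lt.2 (hs.lt i y₀ fun h => hy₀ ⟨i, h.symm⟩).le)

/-! ### Counting rooms and doors -/

lemma exists_min_map (hne : τ.Nonempty) (key : ι → Y → α) :
    ∃ m : ι → Y, (∀ i, m i ∈ τ) ∧ ∀ i, ∀ b ∈ τ, key i (m i) ≤ key i b := by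
  choose m hm using fun i => Finset.exists_min_image τ (key i) hne
  exact ⟨m, fun i => (hm i).1, fun i => (hm i).2⟩

lemma exists_collision [Fintype ι] (hm : ∀ i, m i ∈ τ)
    (hcard : τ.card + 1 = Fintype.card ι) : ∃ i j, i ≠ j ∧ m i = m j := by
  obtain ⟨i, _, j, _, hij, h⟩ := Finset.exists_ne_map_eq_of_card_lt_of_maps_to
    (s := Finset.univ) (t := τ) (f := m) (by rw [Finset.card_univ]; omega) (fun i _ => hm i)
  exact ⟨i, j, hij, h⟩

/-- Two orders share a minimum of `τ`, and the completions are by the top elements for these two.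
The non-slack `x` ensures that they exist: it makes `s d` a candidate for every order `d`. -/
lemma card_rooms_eq_two [Fintype ι] [Nontrivial ι] [Fintype Y] [DecidableEq Y] {s : ι → Y}
    (hinj : ∀ i, Function.Injective (key i)) (hs : IsSlack key s)
    (hcard : τ.card + 1 = Fintype.card ι) (hτ : Dominant key τ)
    (hx : x ∈ τ) (hxs : x ∉ Set.range s) : (rooms key τ).card = 2 := by
  obtain ⟨m, hm, hmle⟩ := exists_min_map ⟨x, hx⟩ key
  obtain ⟨i, j, hij, hmij⟩ := exists_collision hm hcard
  have htop : ∀ d, ∃ y, IsTop key m d y := fun d => exists_isTop key m d (y := s d)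
    fun e he => (hmle e x hx).trans_lt (hs.lt_slack e d x he.symm hxs)
  obtain ⟨a, ha⟩ := htop i
  obtain ⟨b, hb⟩ := htop j
  have haτ := ha.notMem hinj hτ hm hmle hij hmij
  have hbτ := hb.notMem hinj hτ hm hmle hij.symm hmij.symm
  have hab : a ≠ b := ha.ne hτ hm hij hb
  have : rooms key τ = {insert a τ, insert b τ} := by
    ext B
    rw [mem_rooms_iff hcard, Finset.mem_insert, Finset.mem_singleton]
    constructor
    · rintro ⟨y, hy, rfl, hd⟩
      rcases isTop_of_dominant_insert hinj hm hmle hcard hij hmij hy hd with h | h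
      · exact Or.inl (by rw [h.unique hinj ha])
      · exact Or.inr (by rw [h.unique hinj hb])
    · rintro (rfl | rfl)
      · exact ⟨a, haτ, rfl, ha.dominant hτ hm hmle⟩
      · exact ⟨b, hbτ, rfl, hb.dominant hτ hm hmle⟩
  rw [this, Finset.card_pair]
  intro h
  have : a ∈ insert b τ := h ▸ Finset.mem_insert_self a τ
  rcases Finset.mem_insert.1 this with h | h
  · exact hab h
  · exact haτ h

lemma dominant_slack [Fintype ι] [DecidableEq ι] [DecidableEq Y] {s : ι → Y}
    (hs : IsSlack key s) (i₀ : ι) : Dominant key ((Finset.univ.erase i₀).image s) := by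
  intro y
  by_cases hy : y ∈ Set.range s
  · obtain ⟨i, rfl⟩ := hy
    refine ⟨i, fun b _ => ?_⟩
    rcases eq_or_ne b (s i) with rfl | h
    · exact le_rfl
    · exact (hs.lt i b h).le
  · refine ⟨i₀, fun b hb => ?_⟩
    obtain ⟨j, hj, rfl⟩ := Finset.mem_image.1 hb
    exact (hs.lt_slack i₀ j y (Finset.ne_of_mem_erase hj) hy).le

/-- The boundary case: the minimum `s f` is shared by the orders `i₀` and `f`, and only `i₀` has a
top element. One for `f` would exceed `s f` in the order `i₀`, hence be a slack element other than
`s f` and `s i₀`, but such an `s g` is itself the minimum in the order `g`. -/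
lemma card_rooms_slack [Fintype ι] [Nontrivial ι] [DecidableEq ι] [Fintype Y] [DecidableEq Y]
    {s : ι → Y} (hinj : ∀ i, Function.Injective (key i)) (hs : IsSlack key s)
    {y₀ : Y} (hy₀ : y₀ ∉ Set.range s) (i₀ : ι) :
    (rooms key ((Finset.univ.erase i₀).image s)).card = 1 := by
  set τ := (Finset.univ.erase i₀).image s with hτdef
  have hsinj := hs.injective hy₀
  have hτ : Dominant key τ := dominant_slack hs i₀
  have hcard : τ.card + 1 = Fintype.card ι := by
    rw [Finset.card_image_of_injective _ hsinj, Finset.card_erase_of_mem (Finset.mem_univ _),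
      Finset.card_univ]
    have := Fintype.card_pos (α := ι)
    omega
  have hmem : ∀ e, e ≠ i₀ → s e ∈ τ := fun e he =>
    Finset.mem_image_of_mem _ (Finset.mem_erase.2 ⟨he, Finset.mem_univ _⟩)
  obtain ⟨i₁, hi₁⟩ := exists_ne i₀
  obtain ⟨m, hm, hmle⟩ := exists_min_map ⟨_, hmem i₁ hi₁⟩ key
  have hms : ∀ e, e ≠ i₀ → m e = s e := by
    intro e he
    by_contra h
    exact absurd (hmle e _ (hmem e he)) (not_le.2 (hs.lt e _ h))
  obtain ⟨f, hf, hmf⟩ := Finset.mem_image.1 (hm i₀)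
  have hf : f ≠ i₀ := Finset.ne_of_mem_erase hf
  have hmij : m i₀ = m f := by rw [hms f hf, hmf]
  obtain ⟨a, ha⟩ := exists_isTop key m i₀ (y := y₀) fun e he => by
    rw [hms e he]
    exact hs.lt e _ fun h => hy₀ ⟨e, h.symm⟩
  have hno : ∀ x, ¬ IsTop key m f x := by
    intro x hx
    have h1 := hx.1 i₀ hf.symm
    rw [← hmf] at h1
    have hxr : x ∈ Set.range s := by
      by_contra h
      exact absurd h1 (not_lt.2 (hs.lt_slack i₀ f x hf h).le)
    obtain ⟨g, rfl⟩ := hxr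
    by_cases hg : g = i₀
    · subst hg
      exact absurd h1 (not_lt.2 (hs.lt g _ fun h => hf (hsinj h)).le)
    · by_cases hgf : g = f
      · exact lt_irrefl _ (hgf ▸ h1)
      · have := hx.1 g hgf
        rw [hms g hg] at this
        exact lt_irrefl _ this
  rw [Finset.card_eq_one]
  refine ⟨insert a τ, ?_⟩
  ext B
  rw [mem_rooms_iff hcard, Finset.mem_singleton]
  constructor
  · rintro ⟨y, hy, rfl, hd⟩
    rcases isTop_of_dominant_insert hinj hm hmle hcard hf.symm hmij hy hd with h | h
    · rw [h.unique hinj ha]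
    · exact absurd h (hno y)
  · rintro rfl
    exact ⟨a, ha.notMem hinj hτ hm hmle hf.symm hmij, rfl, ha.dominant hτ hm hmle⟩

/-- A door of `B` has no repeated colour. As `B` misses a colour, the element left out has the
colour of exactly one element of the door, and exchanging these two gives the only other door. -/
lemma even_card_doors [Fintype ι] [DecidableEq ι] [DecidableEq Y] {c : Y → ι} {i₀ : ι}
    {B : Finset Y} (hB : B.card = Fintype.card ι) (hc : B.image c ≠ Finset.univ) :
    Even (B.powerset.filter
      fun τ => τ.card + 1 = Fintype.card ι ∧ τ.image c = Finset.univ.erase i₀).card := by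
  set F := B.powerset.filter
      fun τ => τ.card + 1 = Fintype.card ι ∧ τ.image c = Finset.univ.erase i₀ with hF
  have hFmem : ∀ τ, τ ∈ F ↔
      τ ⊆ B ∧ τ.card + 1 = Fintype.card ι ∧ τ.image c = Finset.univ.erase i₀ := by
    intro τ
    rw [hF, Finset.mem_filter, Finset.mem_powerset]
  rcases F.eq_empty_or_nonempty with h | ⟨τ, hτ⟩
  · rw [h]; simp
  obtain ⟨hτB, hτc, hτi⟩ := (hFmem τ).1 hτ
  have h1 : (B \ τ).card = 1 := by
    rw [Finset.card_sdiff_of_subset hτB]; omega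
  obtain ⟨x, hx⟩ := Finset.card_eq_one.1 h1
  have hxB : x ∈ B \ τ := hx ▸ Finset.mem_singleton_self x
  have hxτ := (Finset.mem_sdiff.1 hxB).2
  have hBx : B = insert x τ := by
    rw [← Finset.sdiff_union_of_subset hτB, hx, Finset.insert_eq]
  have hcinj : Set.InjOn c τ := by
    rw [← Finset.card_image_iff, hτi, Finset.card_erase_of_mem (Finset.mem_univ _),
      Finset.card_univ]
    omega
  have hcx : c x ≠ i₀ := by
    intro h
    apply hc
    rw [hBx, Finset.image_insert, hτi, h, Finset.insert_erase (Finset.mem_univ _)]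
  have : c x ∈ τ.image c := hτi ▸ Finset.mem_erase.2 ⟨hcx, Finset.mem_univ _⟩
  obtain ⟨x', hx', hcx'⟩ := Finset.mem_image.1 this
  have hne : x ≠ x' := fun h => hxτ (h ▸ hx')
  have hFeq : F = {τ, B.erase x'} := by
    ext τ'
    rw [hFmem, Finset.mem_insert, Finset.mem_singleton]
    constructor
    · rintro ⟨h1, h2, h3⟩
      by_cases hx1 : x ∈ τ'
      · right
        have hx2 : x' ∉ τ' := by
          intro hx2
          have hinj : Set.InjOn c τ' := by
            rw [← Finset.card_image_iff, h3, Finset.card_erase_of_mem (Finset.mem_univ _),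
              Finset.card_univ]
            omega
          exact hne (hinj hx1 hx2 hcx'.symm)
        refine Finset.eq_of_subset_of_card_le (fun z hz => Finset.mem_erase.2
          ⟨fun h => hx2 (h ▸ hz), h1 hz⟩) ?_
        rw [Finset.card_erase_of_mem (hτB hx')]
        omega
      · left
        refine Finset.eq_of_subset_of_card_le (fun z hz => ?_) (by omega)
        have := h1 hz
        rw [hBx] at this
        exact (Finset.mem_insert.1 this).resolve_left fun h => hx1 (h ▸ hz)
    · rintro (rfl | rfl)
      · exact ⟨hτB, hτc, hτi⟩
      · refine ⟨Finset.erase_subset _ _, ?_, ?_⟩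
        · rw [Finset.card_erase_of_mem (hτB hx')]
          have := Finset.card_pos.2 ⟨x', hτB hx'⟩
          omega
        · rw [← hτi]
          ext e
          simp only [Finset.mem_image, Finset.mem_erase, hBx, Finset.mem_insert]
          constructor
          · rintro ⟨z, ⟨hz, rfl | hz'⟩, rfl⟩
            · exact ⟨x', hx', hcx'⟩
            · exact ⟨z, hz', rfl⟩
          · rintro ⟨z, hz, rfl⟩
            by_cases hzx : z = x'
            · exact ⟨x, ⟨hne, Or.inl rfl⟩, by rw [hzx, hcx']⟩
            · exact ⟨z, ⟨hzx, Or.inr hz⟩, rfl⟩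
  rw [hFeq, Finset.card_pair]
  · exact even_two
  · intro h
    exact Finset.notMem_erase x' B (h ▸ hx')

/-- Scarf's lemma: every colouring that gives the slack elements their own colours has a dominant
set in which all colours occur. -/
theorem exists_colorful [Fintype ι] [Nontrivial ι] [DecidableEq ι] [Fintype Y] [DecidableEq Y]
    {s : ι → Y} (hinj : ∀ i, Function.Injective (key i)) (hs : IsSlack key s)
    {y₀ : Y} (hy₀ : y₀ ∉ Set.range s) (c : Y → ι) (hcs : ∀ i, c (s i) = i) :
    ∃ B : Finset Y, Dominant key B ∧ B.image c = Finset.univ := by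
  classical
  by_contra! hcon
  obtain ⟨i₀⟩ : Nonempty ι := inferInstance
  set R : Finset (Finset Y) := {B | B.card = Fintype.card ι ∧ Dominant key B} with hR
  set D : Finset (Finset Y) := {τ | Dominant key τ ∧ τ.card + 1 = Fintype.card ι ∧
    τ.image c = Finset.univ.erase i₀} with hD
  -- Inclusions of doors in rooms are counted twice: the total is even by rooms if none is
  -- colourful, and odd by doors since only `τ₀` lies in a single room.
  have hcount := Finset.sum_card_bipartiteAbove_eq_sum_card_bipartiteBelow
    (s := D) (t := R) (fun τ B => τ ⊆ B)
  have hright : Even (∑ B ∈ R, (D.bipartiteBelow (fun τ B => τ ⊆ B) B).card) := by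
    refine Finset.even_sum _ fun B hB => ?_
    rw [hR, Finset.mem_filter] at hB
    have heven := even_card_doors (c := c) (i₀ := i₀) hB.2.1 (hcon B hB.2.2)
    suffices h : D.bipartiteBelow (fun τ B => τ ⊆ B) B = B.powerset.filter
        fun τ => τ.card + 1 = Fintype.card ι ∧ τ.image c = Finset.univ.erase i₀ by rwa [h]
    ext τ
    simp only [Finset.bipartiteBelow, hD, Finset.mem_filter, Finset.mem_univ, true_and,
      Finset.mem_powerset]
    exact ⟨fun h => ⟨h.2, h.1.2⟩, fun h => ⟨⟨hB.2.2.mono h.1, h.2⟩, h.1⟩⟩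
  have hrooms : ∀ τ, R.bipartiteAbove (fun τ B => τ ⊆ B) τ = rooms key τ := by
    intro τ
    ext B
    simp only [Finset.bipartiteAbove, hR, rooms, Finset.mem_filter, Finset.mem_univ, true_and]
    tauto
  set τ₀ := (Finset.univ.erase i₀).image s with hτ₀
  have hsinj := hs.injective hy₀
  have hτ₀D : τ₀ ∈ D := by
    rw [hD, Finset.mem_filter]
    refine ⟨Finset.mem_univ _, dominant_slack hs i₀, ?_, ?_⟩
    · rw [Finset.card_image_of_injective _ hsinj, Finset.card_erase_of_mem (Finset.mem_univ _),
        Finset.card_univ]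
      have := Fintype.card_pos (α := ι)
      omega
    · rw [hτ₀, Finset.image_image, show c ∘ s = id from funext hcs, Finset.image_id]
  have hleft : Odd (∑ τ ∈ D, (R.bipartiteAbove (fun τ B => τ ⊆ B) τ).card) := by
    rw [← Finset.add_sum_erase _ _ hτ₀D, hrooms, card_rooms_slack hinj hs hy₀]
    refine Even.one_add (Finset.even_sum _ fun τ hτ => ?_)
    obtain ⟨hne, hτ⟩ := Finset.mem_erase.1 hτ
    rw [hD, Finset.mem_filter] at hτ
    obtain ⟨-, hdom, hcard, himg⟩ := hτ
    -- Slack elements carry their own colours, so a door consisting of slack only is `τ₀`.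
    have : ∃ x ∈ τ, x ∉ Set.range s := by
      by_contra! h
      refine hne (Finset.eq_of_subset_of_card_le (fun z hz => ?_) ?_)
      · obtain ⟨i, rfl⟩ := h z hz
        refine Finset.mem_image_of_mem _ ?_
        rw [← himg]
        exact Finset.mem_image.2 ⟨s i, hz, hcs i⟩
      · rw [hτ₀, Finset.card_image_of_injective _ hsinj,
          Finset.card_erase_of_mem (Finset.mem_univ _), Finset.card_univ]
        omega
    obtain ⟨x, hx, hxs⟩ := this
    rw [hrooms, card_rooms_eq_two hinj hs hcard hdom hx hxs]
    exact even_two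
  rw [hcount] at hleft
  exact (Nat.not_even_iff_odd.2 hleft) hright

/-! ### A covering lemma for the simplex -/

/-- Scarf's lemma for a finite net ordered by coordinates and coloured by the cover: dominance
forces the net points of the colourful set to be close together. -/
lemma exists_approx_of_cover {ι : Type*} [Fintype ι] [Nontrivial ι] (C : ι → Set (ι → ℝ))
    (hC : ∀ y ∈ stdSimplex ℝ ι, ∃ i, y ∈ C i) {η : ℝ} (hη : 0 < η) :
    ∃ y ∈ stdSimplex ℝ ι, ∀ i, y i ≤ η ∨ ∃ x ∈ C i, dist y x ≤ η := by
  classical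
  have hn : (0 : ℝ) < Fintype.card ι := by exact_mod_cast Fintype.card_pos
  set δ := η / Fintype.card ι with hδ
  have hδ0 : 0 < δ := div_pos hη hn
  obtain ⟨t, htΔ, htfin, htcover⟩ := (isCompact_stdSimplex ℝ ι).finite_cover_balls hδ0
  set X := htfin.toFinset
  have hXmem : ∀ x : X, x.1 ∈ stdSimplex ℝ ι := fun x => htΔ (htfin.mem_toFinset.1 x.2)
  have hnet : ∀ z ∈ stdSimplex ℝ ι, ∃ x : X, ∀ i, z i - δ < x.1 i := by
    intro z hz
    obtain ⟨x, hx, hzx⟩ := Set.mem_iUnion₂.1 (htcover hz)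
    refine ⟨⟨x, htfin.mem_toFinset.2 hx⟩, fun i => ?_⟩
    have := (dist_le_pi_dist z x i).trans_lt (Metric.mem_ball.1 hzx)
    rw [Real.dist_eq, abs_lt] at this
    linarith
  choose col hcol using fun x : X => hC x.1 (hXmem x)
  let Y := X ⊕ ι
  -- The slack of `j` is below all coordinates in the order `j` and above them in the others. The
  -- second component of `key` breaks ties.
  let val : ι → Y → ℝ := fun i => Sum.elim (fun x => x.1 i) (fun j => if i = j then -1 else 2)
  let key : ι → Y → ℝ ×ₗ Fin (Fintype.card Y) := fun i y => toLex (val i y, Fintype.equivFin Y y)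
  have hinj : ∀ i, Function.Injective (key i) := by
    intro i y y' h
    have := congrArg (fun p => (ofLex p).2) h
    simpa [key] using this
  have hlt : ∀ i y y', val i y < val i y' → key i y < key i y' := fun i y y' h =>
    Prod.Lex.toLex_lt_toLex.2 (Or.inl h)
  have hle : ∀ i y y', key i y ≤ key i y' → val i y ≤ val i y' := fun i y y' h =>
    not_lt.1 fun h' => not_lt.2 h (hlt i y' y h')
  have hX0 : ∀ (x : X) i, 0 ≤ x.1 i := fun x => (hXmem x).1
  have hX1 : ∀ (x : X) i, x.1 i ≤ 1 := fun x i =>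
    (hXmem x).2 ▸ Finset.single_le_sum (fun j _ => hX0 x j) (Finset.mem_univ i)
  have hs : IsSlack key (Sum.inr : ι → Y) := by
    constructor
    · rintro i (x | j) hy
      · refine hlt _ _ _ ?_
        simp only [val, Sum.elim_inr, Sum.elim_inl, if_true]
        linarith [hX0 x i]
      · have hij : i ≠ j := fun h => hy (h ▸ rfl)
        refine hlt _ _ _ ?_
        simp only [val, Sum.elim_inr, if_true, if_neg hij]
        norm_num
    · rintro i j (x | l) hji hy
      · refine hlt _ _ _ ?_
        simp only [val, Sum.elim_inr, Sum.elim_inl, if_neg hji.symm]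
        linarith [hX1 x i]
      · exact absurd ⟨l, rfl⟩ hy
  obtain ⟨i₀⟩ : Nonempty ι := inferInstance
  obtain ⟨x₀, -⟩ := hnet _ (single_mem_stdSimplex ℝ i₀)
  obtain ⟨B, hdom, hB⟩ := exists_colorful hinj hs (y₀ := Sum.inl x₀) (by simp)
    (Sum.elim col id) (fun _ => rfl)
  -- Only a coordinate whose slack is absent from `B` can witness dominance over a net point, since
  -- slack is least in its own order.
  let Cs : Finset ι := {i | Sum.inr i ∉ B}
  let σ : Finset X := {x | Sum.inl x ∈ B}
  have hdomX : ∀ y : X, ∃ i ∈ Cs, ∀ x ∈ σ, y.1 i ≤ x.1 i := by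
    intro y
    obtain ⟨i, hi⟩ := hdom (Sum.inl y)
    refine ⟨i, ?_, fun x hx => hle i _ _ (hi _ (Finset.mem_filter.1 hx).2)⟩
    refine Finset.mem_filter.2 ⟨Finset.mem_univ _, fun h => ?_⟩
    exact absurd (hi _ h) (not_le.2 (hs.lt i _ (by simp)))
  have hcolor : ∀ i ∈ Cs, ∃ x ∈ σ, col x = i := by
    intro i hi
    obtain ⟨b, hb, hbi⟩ := Finset.mem_image.1 (hB ▸ Finset.mem_univ i)
    rcases b with x | j
    · exact ⟨x, Finset.mem_filter.2 ⟨Finset.mem_univ _, hb⟩, hbi⟩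
    · have : j = i := hbi
      exact absurd (this ▸ hb) (Finset.mem_filter.1 hi).2
  obtain ⟨i₁, hi₁, -⟩ := hdomX x₀
  obtain ⟨y, hy, -⟩ := hcolor i₁ hi₁
  choose a haσ ha using fun i => Finset.exists_min_image σ (fun x => x.1 i) ⟨y, hy⟩
  set μ : ι → ℝ := fun i => (a i).1 i with hμ
  have hCs : (0 : ℝ) < Cs.card := by exact_mod_cast Finset.card_pos.2 ⟨i₁, hi₁⟩
  have hsum1 : ∀ x : X, ∑ i ∈ Cs, x.1 i ≤ 1 := fun x =>
    (hXmem x).2 ▸ Finset.sum_le_sum_of_subset_of_nonneg (Finset.subset_univ _)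
      (fun i _ _ => hX0 x i)
  have hμ1 : ∑ i ∈ Cs, μ i ≤ 1 := (Finset.sum_le_sum fun i _ => ha i y hy).trans (hsum1 y)
  -- Spreading the leftover mass evenly over `Cs` gives a point of the simplex. Were the leftover
  -- larger than `η`, a nearby net point would exceed `μ` throughout `Cs`, against dominance.
  have hslack : 1 - ∑ i ∈ Cs, μ i ≤ η := by
    set δ' := (1 - ∑ i ∈ Cs, μ i) / Cs.card with hδ'
    have hδ'0 : 0 ≤ δ' := div_nonneg (by linarith) hCs.le
    have hz : (fun i => if i ∈ Cs then μ i + δ' else 0) ∈ stdSimplex ℝ ι := by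
      refine ⟨fun i => ?_, ?_⟩
      · dsimp only
        split_ifs
        · exact add_nonneg (hX0 _ _) hδ'0
        · exact le_rfl
      · rw [Finset.sum_ite_mem, Finset.univ_inter, Finset.sum_add_distrib, Finset.sum_const,
          nsmul_eq_mul, hδ']
        field_simp
        ring
    obtain ⟨x, hx⟩ := hnet _ hz
    obtain ⟨i, hi, hix⟩ := hdomX x
    have h1 := hx i
    rw [if_pos hi] at h1
    have h2 : x.1 i ≤ μ i := hix _ (haσ i)
    have h3 : δ' < δ := by linarith
    have h4 : (Cs.card : ℝ) ≤ Fintype.card ι := by exact_mod_cast Finset.card_le_univ _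
    calc 1 - ∑ i ∈ Cs, μ i = δ' * Cs.card := by rw [hδ']; field_simp
      _ ≤ δ * Fintype.card ι := by gcongr
      _ = η := by rw [hδ]; field_simp
  have hnear : ∀ x ∈ σ, ∀ i, i ∈ Cs → x.1 i ≤ μ i + η := by
    intro x hx i hi
    have h1 : x.1 i - μ i ≤ ∑ j ∈ Cs, (x.1 j - μ j) :=
      Finset.single_le_sum (f := fun j => x.1 j - μ j)
        (fun j _ => sub_nonneg.2 (ha j x hx)) hi
    rw [Finset.sum_sub_distrib] at h1
    linarith [hsum1 x]
  have hsmall : ∀ x ∈ σ, ∀ i, i ∉ Cs → x.1 i ≤ η := by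
    intro x hx i hi
    have h1 : x.1 i ≤ ∑ j ∈ Csᶜ, x.1 j :=
      Finset.single_le_sum (fun j _ => hX0 x j) (Finset.mem_compl.2 hi)
    have h2 := Finset.sum_add_sum_compl Cs (fun j => x.1 j)
    have h3 : ∑ j ∈ Cs, μ j ≤ ∑ j ∈ Cs, x.1 j := Finset.sum_le_sum fun j _ => ha j x hx
    linarith [(hXmem x).2]
  refine ⟨y.1, hXmem y, fun i => ?_⟩
  by_cases hi : i ∈ Cs
  · right
    obtain ⟨x, hx, hxi⟩ := hcolor i hi
    refine ⟨x.1, hxi ▸ hcol x, (dist_pi_le_iff hη.le).2 fun j => ?_⟩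
    rw [Real.dist_eq, abs_le]
    by_cases hj : j ∈ Cs
    · have h1 : μ j ≤ x.1 j := ha j x hx
      have h2 : μ j ≤ y.1 j := ha j y hy
      constructor <;> linarith [hnear x hx j hj, hnear y hy j hj]
    · constructor <;> linarith [hsmall x hx j hj, hsmall y hy j hj, hX0 x j, hX0 y j]
  · exact Or.inl (hsmall y hy i hi)

/-- If closed sets `C i` cover the simplex, some point of it lies in `C i` for every `i` in its
support. -/
theorem exists_mem_of_closed_cover {ι : Type*} [Fintype ι] [Nonempty ι] (C : ι → Set (ι → ℝ))
    (hclosed : ∀ i, IsClosed (C i)) (hC : ∀ y ∈ stdSimplex ℝ ι, ∃ i, y ∈ C i) :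
    ∃ y ∈ stdSimplex ℝ ι, ∀ i, 0 < y i → y ∈ C i := by
  classical
  rcases subsingleton_or_nontrivial ι with h | h
  · obtain ⟨i⟩ := ‹Nonempty ι›
    refine ⟨_, single_mem_stdSimplex ℝ i, fun j _ => ?_⟩
    obtain ⟨l, hl⟩ := hC _ (single_mem_stdSimplex ℝ i)
    rwa [Subsingleton.elim j l]
  -- In the limit, a positive coordinate eventually exceeds the tolerance, which leaves only the
  -- alternative of closeness to `C i`.
  · choose y hyΔ hy using fun m : ℕ =>
      exists_approx_of_cover C hC (η := 1 / ((m : ℝ) + 1)) (by positivity)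
    obtain ⟨z, hz, φ, hφ, hlim⟩ := (isCompact_stdSimplex ℝ ι).tendsto_subseq hyΔ
    refine ⟨z, hz, fun i hi => ?_⟩
    have h0 : Filter.Tendsto (fun m => 1 / ((φ m : ℝ) + 1)) Filter.atTop (nhds 0) :=
      (tendsto_one_div_add_atTop_nhds_zero_nat (𝕜 := ℝ)).comp hφ.tendsto_atTop
    rw [← (hclosed i).closure_eq, Metric.mem_closure_iff]
    intro r hr
    have h1 := (tendsto_pi_nhds.1 hlim i).eventually_const_lt (half_lt_self hi)
    have h2 := h0.eventually_lt_const (half_pos hi)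
    have h3 := h0.eventually_lt_const (half_pos hr)
    have h4 := (Metric.tendsto_nhds.1 hlim) (r / 2) (half_pos hr)
    obtain ⟨m, hm1, hm2, hm3, hm4⟩ := (h1.and (h2.and (h3.and h4))).exists
    rcases hy (φ m) i with h | ⟨x, hx, hd⟩
    · simp only [Function.comp_apply] at hm1
      linarith
    · refine ⟨x, hx, ?_⟩
      have := dist_triangle z (y (φ m)) x
      rw [dist_comm z (y (φ m))] at this
      simp only [Function.comp_apply] at hm4
      linarith

end Scarf

/-! ### Expectations over finite product spaces -/

section PiExp

variable {I : Type*} [Fintype I] [DecidableEq I] {Ω : I → Type*} [∀ i, Fintype (Ω i)]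

/-- The sum of `f` over a finite product, weighted by the product of the weights `p i`. -/
def piExp (p : ∀ i, Ω i → ℝ) (f : (∀ i, Ω i) → ℝ) : ℝ := ∑ ω, (∏ i, p i (ω i)) * f ω

/-- On pairs of an outcome and a fresh value of coordinate `i`, exchanging that value with the old
one is an involution; `hp` sums out the discarded coordinate. -/
lemma piExp_update (p : ∀ i, Ω i → ℝ) (i : I) (hp : ∑ a, p i a = 1) (q : Ω i → ℝ)
    (f : (∀ i, Ω i) → ℝ) :
    piExp (Function.update p i q) f =
      ∑ a, q a * piExp p fun ω => f (Function.update ω i a) := by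
  have hupd : ∀ (r : Ω i → ℝ) (ω : ∀ i, Ω i), ∏ j, Function.update p i r j (ω j) =
      r (ω i) * ∏ j ∈ Finset.univ.erase i, p j (ω j) := by
    intro r ω
    rw [← Finset.mul_prod_erase _ _ (Finset.mem_univ i), Function.update_self]
    congr 1
    refine Finset.prod_congr rfl fun j hj => ?_
    rw [Function.update_of_ne (Finset.ne_of_mem_erase hj)]
  have hself : ∀ ω : ∀ i, Ω i, ∏ j, p j (ω j) =
      p i (ω i) * ∏ j ∈ Finset.univ.erase i, p j (ω j) := fun ω =>
    (Finset.mul_prod_erase _ _ (Finset.mem_univ i)).symm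
  calc piExp (Function.update p i q) f
      = ∑ x : (∀ i, Ω i) × Ω i, p i x.2 * (∏ j, Function.update p i q j (x.1 j)) * f x.1 := by
        rw [Fintype.sum_prod_type, piExp]
        refine Finset.sum_congr rfl fun ω _ => ?_
        simp only [mul_assoc]
        rw [← Finset.sum_mul, hp, one_mul]
    _ = ∑ x : (∀ i, Ω i) × Ω i, q x.2 * ((∏ j, p j (x.1 j)) * f (Function.update x.1 i x.2)) := by
        refine Fintype.sum_bijective (fun x => (Function.update x.1 i x.2, x.1 i))
          (Function.Involutive.bijective fun x => by simp) _ _ fun x => ?_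
        simp only [hupd, hself, Function.update_self, Function.update_idem,
          Function.update_eq_self]
        have : ∏ j ∈ Finset.univ.erase i, p j (Function.update x.1 i x.2 j) =
            ∏ j ∈ Finset.univ.erase i, p j (x.1 j) :=
          Finset.prod_congr rfl fun j hj => by
            rw [Function.update_of_ne (Finset.ne_of_mem_erase hj)]
        rw [this]
        ring
    _ = _ := by
        rw [Fintype.sum_prod_type_right]
        simp only [piExp, Finset.mul_sum]

lemma piExp_eq_sum (p : ∀ i, Ω i → ℝ) (i : I) (hp : ∑ a, p i a = 1) (f : (∀ i, Ω i) → ℝ) :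
    piExp p f = ∑ a, p i a * piExp p fun ω => f (Function.update ω i a) := by
  rw [← piExp_update p i hp, Function.update_eq_self]

lemma piExp_sum {J : Type*} (s : Finset J) (p : ∀ i, Ω i → ℝ) (f : J → (∀ i, Ω i) → ℝ) :
    piExp p (fun ω => ∑ j ∈ s, f j ω) = ∑ j ∈ s, piExp p (f j) := by
  simp only [piExp, Finset.mul_sum]
  exact Finset.sum_comm

lemma piExp_add (p : ∀ i, Ω i → ℝ) (f g : (∀ i, Ω i) → ℝ) :
    piExp p (fun ω => f ω + g ω) = piExp p f + piExp p g := by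
  simp only [piExp, mul_add, Finset.sum_add_distrib]

lemma piExp_mul_const (p : ∀ i, Ω i → ℝ) (f : (∀ i, Ω i) → ℝ) (c : ℝ) :
    piExp p (fun ω => f ω * c) = piExp p f * c := by
  simp only [piExp, ← mul_assoc, Finset.sum_mul]

lemma piExp_const (p : ∀ i, Ω i → ℝ) (hp : ∀ i, ∑ a, p i a = 1) (c : ℝ) :
    piExp p (fun _ => c) = c := by
  rw [piExp, ← Finset.sum_mul, ← Fintype.piFinset_univ, ← Finset.prod_univ_sum]
  simp [hp]

lemma piExp_mono {p : ∀ i, Ω i → ℝ} (hp : ∀ i a, 0 ≤ p i a) {f g : (∀ i, Ω i) → ℝ}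
    (h : ∀ ω, f ω ≤ g ω) : piExp p f ≤ piExp p g :=
  Finset.sum_le_sum fun ω _ =>
    mul_le_mul_of_nonneg_left (h ω) (Finset.prod_nonneg fun i _ => hp i _)

lemma piExp_coord (p : ∀ i, Ω i → ℝ) (hp : ∀ i, ∑ a, p i a = 1) (i : I) (g : Ω i → ℝ) :
    piExp p (fun ω => g (ω i)) = ∑ a, p i a * g a := by
  rw [piExp_eq_sum p i (hp i)]
  simp only [Function.update_self, piExp_const p hp]

/-- Every finite game has a Nash equilibrium in mixed strategies. -/
theorem exists_mixed_nash [Nonempty I] [∀ i, Nonempty (Ω i)] (f : I → (∀ i, Ω i) → ℝ) :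
    ∃ x : ∀ i, Ω i → ℝ, (∀ i, x i ∈ stdSimplex ℝ (Ω i)) ∧
      ∀ i a, (piExp x fun ω => f i (Function.update ω i a)) ≤ piExp x (f i) := by
  classical
  have hn : (0 : ℝ) < Fintype.card I := by exact_mod_cast Fintype.card_pos
  -- One simplex carries the strategies of all players; the scaling makes the players' total weights
  -- average one.
  let X : ((Σ i, Ω i) → ℝ) → ∀ i, Ω i → ℝ := fun y i a => Fintype.card I * y ⟨i, a⟩
  let U : (Σ i, Ω i) → ((Σ i, Ω i) → ℝ) → ℝ := fun a y =>
    piExp (X y) fun ω => f a.1 (Function.update ω a.1 a.2)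
  have hU : ∀ a, Continuous (U a) := by
    intro a
    simp only [U, piExp, X]
    fun_prop
  -- Strategy `a` owns the points where its player has total weight at most one and `a` is a best
  -- reply. Some player always has weight at most one, so these sets cover.
  let C : (Σ i, Ω i) → Set ((Σ i, Ω i) → ℝ) := fun a =>
    {y | ∑ b, X y a.1 b ≤ 1} ∩ ⋂ b, {y | U ⟨a.1, b⟩ y ≤ U a y}
  have hclosed : ∀ a, IsClosed (C a) := fun a =>
    (isClosed_le (by simp only [X]; fun_prop) continuous_const).inter
      (isClosed_iInter fun b => isClosed_le (hU _) (hU _))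
  have htotal : ∀ y ∈ stdSimplex ℝ (Σ i, Ω i), ∑ i, ∑ b, X y i b = ∑ _i : I, (1 : ℝ) := by
    intro y hy
    simp only [X, ← Finset.mul_sum]
    rw [← Fintype.sum_sigma (fun a => y a), hy.2]
    simp
  have : Nonempty (Σ i, Ω i) := ⟨⟨Classical.arbitrary I, Classical.arbitrary _⟩⟩
  obtain ⟨y, hy, hyC⟩ := Scarf.exists_mem_of_closed_cover C hclosed fun y hy => by
    obtain ⟨i, -, hi⟩ := Finset.exists_le_of_sum_le Finset.univ_nonempty (htotal y hy).le
    obtain ⟨a, ha⟩ := Finite.exists_max fun a : Ω i => U ⟨i, a⟩ y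
    exact ⟨⟨i, a⟩, hi, Set.mem_iInter.2 ha⟩
  -- A player of weight above one would have a supported strategy whose set omits `y`. As the
  -- weights average one, all of them equal one.
  have hle : ∀ i, ∑ b, X y i b ≤ 1 := by
    intro i
    by_contra! h
    obtain ⟨b, -, hb⟩ := Finset.exists_lt_of_sum_lt (s := Finset.univ) (f := fun _ : Ω i => (0 : ℝ))
      (g := X y i) (by simpa using one_pos.trans h)
    exact absurd (hyC ⟨i, b⟩ (pos_of_mul_pos_right hb hn.le)).1 (not_le.2 h)
  have hsum : ∀ i, ∑ b, X y i b = 1 := fun i =>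
    (Finset.sum_eq_sum_iff_of_le fun i _ => hle i).1 (htotal y hy) i (Finset.mem_univ i)
  have h0 : ∀ i b, 0 ≤ X y i b := fun i b => mul_nonneg hn.le (hy.1 _)
  refine ⟨X y, fun i => ⟨h0 i, hsum i⟩, fun i a => ?_⟩
  rw [piExp_eq_sum _ i (hsum i) (f i)]
  calc U ⟨i, a⟩ y = ∑ b, X y i b * U ⟨i, a⟩ y := by rw [← Finset.sum_mul, hsum, one_mul]
    _ ≤ ∑ b, X y i b * U ⟨i, b⟩ y := by
      refine Finset.sum_le_sum fun b _ => ?_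
      rcases (h0 i b).eq_or_lt with h | h
      · rw [← h, zero_mul, zero_mul]
      · exact mul_le_mul_of_nonneg_left
          (Set.mem_iInter.1 (hyC ⟨i, b⟩ (pos_of_mul_pos_right h hn.le)).2 a) h.le

end PiExp

/-! ### The selection rule -/

namespace Persuasion

variable {N k : ℕ} (e : Fin N → ℝ)

lemma ordered_succ (m : Fin N) : ordered e (m + 1) = e (Tuple.sort (fun i => - e i) m) := by
  simp [ordered]

lemma sort_antitone {m m' : Fin N} (h : m ≤ m') :
    e (Tuple.sort (fun i => - e i) m') ≤ e (Tuple.sort (fun i => - e i) m) := by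
  have := Tuple.monotone_sort (fun i => - e i) h
  simpa using this

lemma sum_Icc_one_eq_sum_range (f : ℕ → ℝ) (m : ℕ) :
    ∑ j ∈ Finset.Icc 1 m, f j = ∑ j ∈ Finset.range m, f (j + 1) := by
  induction m with
  | zero => simp
  | succ m ih => rw [Finset.sum_Icc_succ_top (by omega), ih, Finset.sum_range_succ]

lemma sum_ordered (hk : 1 ≤ k) (hkN : k ≤ N) :
    ∑ j ∈ Finset.Icc 1 k, ordered e j = ∑ i, max (e i - ordered e k) 0 + k * ordered e k := by
  obtain ⟨m, rfl⟩ : ∃ m, k = m + 1 := ⟨k - 1, by omega⟩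
  set τ := ordered e (m + 1) with hτ
  have hτ' : τ = e (Tuple.sort (fun i => - e i) ⟨m, hkN⟩) := ordered_succ e ⟨m, hkN⟩
  have hge : ∀ j ∈ Finset.range (m + 1), max (ordered e (j + 1) - τ) 0 = ordered e (j + 1) - τ := by
    intro j hj
    have hj := Finset.mem_range.1 hj
    refine max_eq_left (sub_nonneg.2 ?_)
    rw [hτ', ordered_succ e ⟨j, by omega⟩]
    exact sort_antitone e (Fin.mk_le_mk.2 (by omega))
  have hle : ∀ j ∈ Finset.range N, j ∉ Finset.range (m + 1) →
      max (ordered e (j + 1) - τ) 0 = 0 := by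
    intro j hj hj'
    rw [Finset.mem_range] at hj hj'
    refine max_eq_right (sub_nonpos.2 ?_)
    rw [hτ', ordered_succ e ⟨j, hj⟩]
    exact sort_antitone e (Fin.mk_le_mk.2 (by omega))
  have h1 : ∑ i, max (e i - τ) 0 = ∑ j ∈ Finset.range (m + 1), (ordered e (j + 1) - τ) := by
    rw [← Finset.sum_congr rfl hge,
      Finset.sum_subset (Finset.range_subset_range.2 hkN) hle,
      ← Fin.sum_univ_eq_sum_range (fun j => max (ordered e (j + 1) - τ) 0)]
    simp only [ordered_succ]
    exact (Equiv.sum_comp (Tuple.sort fun i => - e i) fun i => max (e i - τ) 0).symm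
  rw [h1, sum_Icc_one_eq_sum_range, Finset.sum_sub_distrib]
  simp

lemma card_winners_lt (hk : 1 ≤ k) (hkN : k ≤ N) : (winners k e).card < k := by
  obtain ⟨m, rfl⟩ : ∃ m, k = m + 1 := ⟨k - 1, by omega⟩
  have h : winners (m + 1) e ⊆
      (Finset.Iio (⟨m, hkN⟩ : Fin N)).image (Tuple.sort fun i => - e i) := by
    intro i hi
    rw [winners, Finset.mem_filter, ordered_succ e ⟨m, hkN⟩] at hi
    refine Finset.mem_image.2 ⟨(Tuple.sort fun i => - e i).symm i, ?_, by simp⟩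
    rw [Finset.mem_Iio]
    by_contra! hlt
    have := sort_antitone e hlt
    rw [Equiv.apply_symm_apply] at this
    exact absurd hi.2 (not_lt.2 this)
  have := (Finset.card_le_card h).trans Finset.card_image_le
  rw [Fin.card_Iio] at this
  exact Nat.lt_succ_of_le this

lemma disjoint_winners_tied : Disjoint (winners k e) (tied k e) := by
  rw [winners, tied, Finset.disjoint_filter]
  intro i _ h h'
  exact absurd h'.symm h.ne

lemma le_card_winners_add_card_tied (hk : 1 ≤ k) (hkN : k ≤ N) :
    k ≤ (winners k e).card + (tied k e).card := by
  obtain ⟨m, rfl⟩ : ∃ m, k = m + 1 := ⟨k - 1, by omega⟩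
  have h : (Finset.Iic (⟨m, hkN⟩ : Fin N)).image (Tuple.sort fun i => - e i) ⊆
      winners (m + 1) e ∪ tied (m + 1) e := by
    intro i hi
    obtain ⟨j, hj, rfl⟩ := Finset.mem_image.1 hi
    have := sort_antitone e (Finset.mem_Iic.1 hj)
    rw [← ordered_succ e ⟨m, hkN⟩] at this
    simp only [winners, tied, Finset.mem_union, Finset.mem_filter, Finset.mem_univ, true_and]
    exact this.lt_or_eq.imp id Eq.symm
  have := Finset.card_le_card h
  rwa [Finset.card_image_of_injective _ (Equiv.injective _), Fin.card_Iic,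
    Finset.card_union_of_disjoint (disjoint_winners_tied e)] at this

lemma card_tied_pos (hk : 1 ≤ k) (hkN : k ≤ N) : 0 < ((tied k e).card : ℝ) := by
  have h1 := card_winners_lt e hk hkN
  have h2 := le_card_winners_add_card_tied e hk hkN
  exact_mod_cast (by omega : 0 < (tied k e).card)

lemma selectProb_nonneg (hk : 1 ≤ k) (hkN : k ≤ N) (i : Fin N) : 0 ≤ selectProb k e i := by
  have h : ((winners k e).card : ℝ) ≤ k := by exact_mod_cast (card_winners_lt e hk hkN).le
  unfold selectProb
  split_ifs
  · exact zero_le_one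
  · exact div_nonneg (sub_nonneg.2 h) (Nat.cast_nonneg _)
  · exact le_rfl

lemma selectProb_le_one (hk : 1 ≤ k) (hkN : k ≤ N) (i : Fin N) : selectProb k e i ≤ 1 := by
  have h : (k : ℝ) ≤ (winners k e).card + (tied k e).card := by
    exact_mod_cast le_card_winners_add_card_tied e hk hkN
  unfold selectProb
  split_ifs
  · exact le_rfl
  · rw [div_le_one (card_tied_pos e hk hkN)]
    linarith
  · exact zero_le_one

lemma sum_selectProb_mul (c : Fin N → ℝ) : ∑ i, selectProb k e i * c i =
    ∑ i ∈ winners k e, c i +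
      ((k : ℝ) - (winners k e).card) / (tied k e).card * ∑ i ∈ tied k e, c i := by
  have h : ∀ i, selectProb k e i * c i = (if i ∈ winners k e then c i else 0) +
      if i ∈ tied k e then ((k : ℝ) - (winners k e).card) / (tied k e).card * c i else 0 := by
    intro i
    unfold selectProb
    by_cases h1 : i ∈ winners k e
    · simp [h1, Finset.disjoint_left.1 (disjoint_winners_tied e) h1]
    · by_cases h2 : i ∈ tied k e <;> simp [h1, h2]
  simp only [h, Finset.sum_add_distrib, Finset.sum_ite_mem, Finset.univ_inter, Finset.mul_sum]

lemma sum_selectProb (hk : 1 ≤ k) (hkN : k ≤ N) : ∑ i, selectProb k e i = k := by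
  have h := sum_selectProb_mul (k := k) e fun _ => 1
  have ht := card_tied_pos e hk hkN
  simp only [mul_one, Finset.sum_const, nsmul_eq_mul] at h
  rw [h]
  field_simp
  ring

/-- Tied agents have equal means, so random tie-breaking leaves the selected total unchanged, and
the welfare splits over agents. -/
lemma sum_selectProb_mul_self (hk : 1 ≤ k) (hkN : k ≤ N) :
    ∑ i, selectProb k e i * e i = ∑ j ∈ Finset.Icc 1 k, ordered e j := by
  have ht := card_tied_pos e hk hkN
  have h1 : ∑ i ∈ tied k e, e i = (tied k e).card * ordered e k := by
    rw [← nsmul_eq_mul, ← Finset.sum_const]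
    exact Finset.sum_congr rfl fun i hi => (Finset.mem_filter.1 hi).2
  have h2 : ∑ i, max (e i - ordered e k) 0 = ∑ i ∈ winners k e, (e i - ordered e k) := by
    rw [winners, Finset.sum_filter]
    refine Finset.sum_congr rfl fun i _ => ?_
    split_ifs with h
    · exact max_eq_left (sub_nonneg.2 h.le)
    · exact max_eq_right (sub_nonpos.2 (not_lt.1 h))
  rw [sum_selectProb_mul, sum_ordered e hk hkN, h1, h2, Finset.sum_sub_distrib, Finset.sum_const,
    nsmul_eq_mul]
  field_simp
  ring

/-- The competitors of `i` with posterior mean at least `T`. -/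
noncomputable def rivals (T : ℝ) (i : Fin N) : Finset (Fin N) := {j | j ≠ i ∧ T ≤ e j}

/-! ### Selection relative to a threshold -/

variable {e} {T : ℝ} {i : Fin N}

lemma le_ordered_of_le_card_rivals (hk : 1 ≤ k) (hkN : k ≤ N) (h : k ≤ (rivals e T i).card) :
    T ≤ ordered e k := by
  by_contra! hlt
  have hsub : rivals e T i ⊆ winners k e := fun j hj =>
    Finset.mem_filter.2 ⟨Finset.mem_univ _, hlt.trans_le (Finset.mem_filter.1 hj).2.2⟩
  have := Finset.card_le_card hsub
  have := card_winners_lt e hk hkN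
  omega

lemma mul_le_sum_ordered (hk : 1 ≤ k) (hkN : k ≤ N) (h : k ≤ (rivals e T i).card) :
    k * T ≤ ∑ j ∈ Finset.Icc 1 k, ordered e j := by
  rw [sum_ordered e hk hkN]
  have h1 := mul_le_mul_of_nonneg_left (le_ordered_of_le_card_rivals hk hkN h)
    (Nat.cast_nonneg (α := ℝ) k)
  have h2 : 0 ≤ ∑ i, max (e i - ordered e k) 0 := Finset.sum_nonneg fun i _ => le_max_right _ _
  linarith

lemma selectProb_eq_zero (hk : 1 ≤ k) (hkN : k ≤ N) (hi : e i < T)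
    (h : k ≤ (rivals e T i).card) : selectProb k e i = 0 := by
  have := hi.trans_le (le_ordered_of_le_card_rivals hk hkN h)
  simp [selectProb, winners, tied, this.le, this.ne]

/-- In a tie, all other winners and tied agents are rivals. There are thus exactly `k` winners and
tied agents, and the tie-breaking fraction is one. -/
lemma selectProb_eq_one (hk : 1 ≤ k) (hkN : k ≤ N) (hi : T ≤ e i)
    (h : (rivals e T i).card < k) : selectProb k e i = 1 := by
  by_cases hw : i ∈ winners k e
  · simp [selectProb, hw]
  have h1 := le_card_winners_add_card_tied e hk hkN
  have hmem : ∀ j, j ∈ winners k e ∪ tied k e ↔ ordered e k ≤ e j := by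
    intro j
    simp only [winners, tied, Finset.mem_union, Finset.mem_filter, Finset.mem_univ, true_and]
    exact ⟨fun h => h.elim le_of_lt ge_of_eq, fun h => h.lt_or_eq.imp id Eq.symm⟩
  rw [← Finset.card_union_of_disjoint (disjoint_winners_tied e)] at h1
  have hle : e i ≤ ordered e k := by
    by_contra! h
    exact hw (Finset.mem_filter.2 ⟨Finset.mem_univ _, h⟩)
  have hsub : (winners k e ∪ tied k e).erase i ⊆ rivals e T i := by
    intro j hj
    obtain ⟨hne, hj⟩ := Finset.mem_erase.1 hj
    exact Finset.mem_filter.2 ⟨Finset.mem_univ _, hne,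
      hi.trans (hle.trans ((hmem j).1 hj))⟩
  have h2 := Finset.card_le_card hsub
  have h3 := Finset.pred_card_le_card_erase (a := i) (s := winners k e ∪ tied k e)
  have hmi : i ∈ winners k e ∪ tied k e := by
    by_contra hmi
    rw [Finset.erase_eq_of_notMem hmi] at h2
    omega
  have ht : i ∈ tied k e := (Finset.mem_union.1 hmi).resolve_left hw
  rw [selectProb, if_neg hw, if_pos ht, div_eq_one_iff_eq (card_tied_pos e hk hkN).ne']
  rw [Finset.card_union_of_disjoint (disjoint_winners_tied e)] at h1 h3
  have : k = (winners k e).card + (tied k e).card := by omega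
  rw [sub_eq_iff_eq_add]
  exact_mod_cast this.trans (add_comm _ _)

end Persuasion

/-! ### Best responses -/

namespace Persuasion

/-- Greedy pooling: `c` takes units from the highest values downwards while their mean stays at
least `T`, and `w` is the value of the first unit that does not fit. -/
lemma exists_prefix {V : Finset ℝ} (l : V → ℕ) {T : ℝ} (hl : ∑ v, (l v : ℝ) * ((v : ℝ) - T) < 0) :
    ∃ (c : V → ℕ) (w : V), (∀ v, c v ≤ l v) ∧ (∀ v, v < w → c v = 0) ∧
      (∀ v, w < v → c v = l v) ∧ c w < l w ∧ 0 ≤ ∑ v, (c v : ℝ) * ((v : ℝ) - T) ∧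
      ∑ v, (c v : ℝ) * ((v : ℝ) - T) + ((w : ℝ) - T) < 0 := by
  classical
  set F := (Finset.Iic l).filter fun c => (∀ v w, v < w → c v ≠ 0 → c w = l w) ∧
    0 ≤ ∑ v : V, (c v : ℝ) * ((v : ℝ) - T) with hF
  have h0 : (0 : V → ℕ) ∈ F := by
    simp [hF]
  obtain ⟨c, hc, hmax⟩ := Finset.exists_max_image F (fun c => ∑ v, c v) ⟨_, h0⟩
  obtain ⟨hcl, hpre, hpos⟩ := Finset.mem_filter.1 hc
  have hcl : ∀ v, c v ≤ l v := Finset.mem_Iic.1 hcl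
  have hne : (Finset.univ.filter fun v => c v < l v).Nonempty := by
    by_contra h
    rw [Finset.not_nonempty_iff_eq_empty, Finset.filter_eq_empty_iff] at h
    have : c = l := funext fun v => le_antisymm (hcl v) (not_lt.1 (h (Finset.mem_univ v)))
    rw [this] at hpos
    linarith
  obtain ⟨w, hw, hwmax⟩ := Finset.exists_max_image _ id hne
  have hw := (Finset.mem_filter.1 hw).2
  have hgt : ∀ v, w < v → c v = l v := by
    intro v hv
    by_contra h
    exact absurd (hwmax v (Finset.mem_filter.2 ⟨Finset.mem_univ _, lt_of_le_of_ne (hcl v) h⟩))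
      (not_le.2 hv)
  have hlt : ∀ v, v < w → c v = 0 := by
    intro v hv
    by_contra h
    exact absurd (hpre v w hv h) hw.ne
  refine ⟨c, w, hcl, hlt, hgt, hw, hpos, ?_⟩
  by_contra! hcon
  have hcast : ∀ v : V, (((c + Pi.single w 1 : V → ℕ) v : ℕ) : ℝ) = c v + (Pi.single w 1 : V → ℝ) v := by
    intro v
    by_cases h : v = w
    · subst h; simp
    · simp [Pi.single_eq_of_ne h]
  have hmem : c + Pi.single w 1 ∈ F := by
    refine Finset.mem_filter.2 ⟨Finset.mem_Iic.2 fun v => ?_, fun v v' hv hne => ?_, ?_⟩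
    · by_cases h : v = w
      · subst h; simpa using hw
      · simpa [Pi.single_eq_of_ne h] using hcl v
    · have hwv : w ≤ v := by
        by_contra! h
        exact hne (by simp [Pi.single_eq_of_ne h.ne, hlt v h])
      have := hwv.trans_lt hv
      simp [Pi.single_eq_of_ne this.ne', hgt v' this]
    · simp only [hcast, add_mul, Finset.sum_add_distrib]
      simpa [Pi.single_apply] using hcon
  have := hmax _ hmem
  simp [Finset.sum_add_distrib] at this

/-- Here `R` is mass weighted by winning probability. The difference `R - α * c` is nonnegative
below `w` and nonpositive above, so monotonicity allows `u v` to be replaced by `u w`. A positive `u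
w` cancels; a zero one forces every term to vanish. -/
lemma prefix_dichotomy {V : Finset ℝ} {l c : V → ℕ} {w : V} {R : V → ℝ} {u : ℝ → ℝ} {α : ℝ}
    (hlt : ∀ v, v < w → c v = 0) (hgt : ∀ v, w < v → c v = l v)
    (hR0 : ∀ v, 0 ≤ R v) (hRl : ∀ v, R v ≤ α * l v)
    (hu0 : ∀ v : V, 0 ≤ u v) (hu : ∀ v v' : V, v ≤ v' → u v ≤ u v')
    (h : α * ∑ v, c v * u v ≤ ∑ v, R v * u v) :
    α * ∑ v, (c v : ℝ) ≤ ∑ v, R v ∨ u w = 0 ∧ ∀ v : V, w < v → 0 < u v → R v = α * l v := by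
  have h0 : 0 ≤ ∑ v, (R v - α * c v) * u v := by
    simp only [sub_mul, Finset.sum_sub_distrib]
    rw [Finset.mul_sum] at h
    simp only [mul_assoc]
    linarith
  have hle : ∀ v, (R v - α * c v) * u v ≤ (R v - α * c v) * u w := by
    intro v
    rcases lt_trichotomy v w with h | rfl | h
    · rw [hlt v h]
      exact mul_le_mul_of_nonneg_left (hu v w h.le) (by simpa using hR0 v)
    · exact le_rfl
    · rw [hgt v h]
      exact mul_le_mul_of_nonpos_left (hu w v h.le) (sub_nonpos.2 (hRl v))
  have h1 := h0.trans (Finset.sum_le_sum fun v _ => hle v)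
  rcases (hu0 w).eq_or_lt with hw | hw
  · right
    refine ⟨hw.symm, fun v hv hpos => ?_⟩
    have hle0 : ∀ v, (R v - α * c v) * u v ≤ 0 := fun v => by simpa [← hw] using hle v
    have hsum : ∑ v, (R v - α * c v) * u v = 0 :=
      le_antisymm (Finset.sum_nonpos fun v _ => hle0 v) h0
    have := (Finset.sum_eq_zero_iff_of_nonpos fun v _ => hle0 v).1 hsum v (Finset.mem_univ v)
    rw [hgt v hv] at this
    rcases mul_eq_zero.1 this with h | h
    · linarith
    · exact absurd h hpos.ne'
  · left
    rw [← Finset.sum_mul, Finset.sum_sub_distrib, ← Finset.mul_sum] at h1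
    have := nonneg_of_mul_nonneg_left h1 hw
    linarith

namespace Game

variable {N : ℕ} {ε : ℝ} {G : Game N ε} {S : Type*} [Fintype S] {i : Fin N}

lemma Scheme.kernel_mul_prior (z : G.Scheme S i) (s : S) (v : G.V) :
    z.kernel s v * G.prior i v = ε * z.mass s v := by
  rw [kernel, prior]
  -- The kernel divides by zero at a value of prior probability zero, but no mass lies there.
  by_cases ht : G.t i v = 0
  · have := Finset.single_le_sum (f := fun s => z.mass s v) (fun _ _ => Nat.zero_le _)
      (Finset.mem_univ s)
    rw [z.sum_mass v, ht] at this
    simp [ht, Nat.le_zero.1 this]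
  · have : (G.t i v : ℝ) ≠ 0 := by exact_mod_cast ht
    field_simp

lemma Scheme.signalProb_eq (z : G.Scheme S i) (s : S) :
    z.signalProb s = ε * ∑ v, (z.mass s v : ℝ) := by
  simp only [signalProb, kernel_mul_prior, Finset.mul_sum]

lemma Scheme.condExp_eq (hε : 0 < ε) (z : G.Scheme S i) (f : ℝ → ℝ) (s : S) :
    z.condExp f s = (∑ v : G.V, (z.mass s v : ℝ) * f v) / ∑ v, (z.mass s v : ℝ) := by
  simp only [condExp, kernel_mul_prior, ← Finset.mul_sum]
  rw [← mul_div_mul_left _ (∑ v, (z.mass s v : ℝ)) hε.ne']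
  congr 1
  rw [Finset.mul_sum]
  exact Finset.sum_congr rfl fun v _ => by ring

lemma Scheme.signalProb_mul_condExp (hε : 0 < ε) (z : G.Scheme S i) (f : ℝ → ℝ) (s : S) :
    z.signalProb s * z.condExp f s = ε * ∑ v : G.V, (z.mass s v : ℝ) * f v := by
  rw [signalProb_eq, condExp_eq hε]
  by_cases h : ∑ v, (z.mass s v : ℝ) = 0
  · have h0 : ∀ v, (z.mass s v : ℝ) = 0 := fun v =>
      (Finset.sum_eq_zero_iff_of_nonneg fun v _ => Nat.cast_nonneg _).1 h v (Finset.mem_univ v)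
    simp [h0]
  · field_simp

lemma Scheme.sum_mass_low (z : G.Scheme S i) (hε : 0 < ε) {T : ℝ} {s : S}
    (hne : ∑ v, (z.mass s v : ℝ) ≠ 0) (hs : z.postMean s < T) :
    ∑ v : G.V, (z.mass s v : ℝ) * (v - T) < 0 := by
  have hpos : 0 < ∑ v, (z.mass s v : ℝ) :=
    lt_of_le_of_ne (Finset.sum_nonneg fun v _ => Nat.cast_nonneg _) hne.symm
  rw [postMean, condExp_eq hε, div_lt_iff₀ hpos] at hs
  simp only [mul_sub, Finset.sum_sub_distrib, ← Finset.sum_mul]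
  linarith

/-- The scheme that changes `z` on the signals in `L`: the mass `c` is moved to the signal `s₁`
and the rest of the mass of `L` to the signal `s₂`. -/
def Scheme.regroup [DecidableEq S] (z : G.Scheme S i) (L : Finset S) (c : G.V → ℕ)
    (hc : ∀ v, c v ≤ ∑ s ∈ L, z.mass s v) {s₁ s₂ : S} (h₁ : s₁ ∈ L) (h₂ : s₂ ∈ L) :
    G.Scheme S i where
  mass s v := if s ∈ L then
      (if s = s₁ then c v else 0) + (if s = s₂ then ∑ s ∈ L, z.mass s v - c v else 0)
    else z.mass s v
  sum_mass v := by
    rw [← Finset.sum_add_sum_compl L, ← z.sum_mass v,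
      ← Finset.sum_add_sum_compl L (fun s => z.mass s v)]
    congr 1
    · rw [Finset.sum_congr rfl fun s hs => if_pos hs, Finset.sum_add_distrib,
        Finset.sum_ite_eq' L s₁, Finset.sum_ite_eq' L s₂, if_pos h₁, if_pos h₂]
      have := hc v
      omega
    · exact Finset.sum_congr rfl fun s hs => if_neg (Finset.mem_compl.1 hs)

/-- There are at least as many labels as units, and labels outside `L` use at least one unit each.
Two units in `L` thus leave two labels there, for the pool and for its remainder. -/
lemma Scheme.exists_pair_low (z : G.Scheme S i) (hS : ∑ v, G.t i v ≤ Fintype.card S)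
    (L : Finset S) (hL : ∀ s, s ∉ L → 1 ≤ ∑ v, z.mass s v)
    (h2 : 2 ≤ ∑ v, ∑ s ∈ L, z.mass s v) : ∃ s₁ ∈ L, ∃ s₂ ∈ L, s₁ ≠ s₂ := by
  classical
  rw [← Finset.one_lt_card]
  have h1 : ∑ v, G.t i v = ∑ s ∈ L, ∑ v, z.mass s v + ∑ s ∈ Lᶜ, ∑ v, z.mass s v := by
    rw [Finset.sum_add_sum_compl, Finset.sum_comm]
    exact Finset.sum_congr rfl fun v _ => (z.sum_mass v).symm
  have h3 : Lᶜ.card ≤ ∑ s ∈ Lᶜ, ∑ v, z.mass s v := by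
    rw [Finset.card_eq_sum_ones]
    exact Finset.sum_le_sum fun s hs => hL s (Finset.mem_compl.1 hs)
  rw [Finset.sum_comm] at h2
  have h4 := Finset.card_add_card_compl L
  omega

/-- An upper bound on the utility that a best response can give up on the signals whose posterior
mean is below `T`, in terms of the mass `c` that can be pooled above `T`. -/
lemma Scheme.pooled_le_of_best (hε : 0 < ε) (z : G.Scheme S i) {H : ℝ → ℝ} {T α : ℝ}
    (hH0 : ∀ e, 0 ≤ H e) (hhigh : ∀ e, T ≤ e → α ≤ H e)
    (hS : ∑ v, G.t i v ≤ Fintype.card S) {u : ℝ → ℝ} (hu0 : ∀ v : G.V, 0 ≤ u v)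
    (hbest : ∀ z' : G.Scheme S i,
      ∑ s, H (z'.postMean s) * ∑ v : G.V, (z'.mass s v : ℝ) * u v ≤
        ∑ s, H (z.postMean s) * ∑ v : G.V, (z.mass s v : ℝ) * u v)
    (L : Finset S) (hL : ∀ s, s ∉ L → 1 ≤ ∑ v, z.mass s v) {c : G.V → ℕ} {w : G.V}
    (hc : ∀ v, c v ≤ ∑ s ∈ L, z.mass s v) (hw : c w < ∑ s ∈ L, z.mass s w)
    (hcT : 0 ≤ ∑ v : G.V, (c v : ℝ) * (v - T)) :
    α * ∑ v : G.V, (c v : ℝ) * u v ≤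
      ∑ v : G.V, (∑ s ∈ L, H (z.postMean s) * z.mass s v) * u v := by
  classical
  have hR : ∑ v : G.V, (∑ s ∈ L, H (z.postMean s) * z.mass s v) * u v =
      ∑ s ∈ L, H (z.postMean s) * ∑ v : G.V, (z.mass s v : ℝ) * u v := by
    simp only [Finset.sum_mul, Finset.mul_sum]
    rw [Finset.sum_comm]
    simp only [mul_assoc]
  have hterm : ∀ (z : G.Scheme S i) s,
      0 ≤ H (z.postMean s) * ∑ v : G.V, (z.mass s v : ℝ) * u v := fun z s =>
    mul_nonneg (hH0 _) (Finset.sum_nonneg fun v _ => mul_nonneg (Nat.cast_nonneg _) (hu0 v))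
  rw [hR]
  by_cases hc0 : ∀ v, c v = 0
  · simp only [hc0, Nat.cast_zero, zero_mul, Finset.sum_const_zero, mul_zero]
    exact Finset.sum_nonneg fun s _ => hterm z s
  push Not at hc0
  obtain ⟨v₀, hv₀⟩ := hc0
  have hcpos : 0 < ∑ v, c v :=
    Finset.sum_pos' (fun v _ => Nat.zero_le _) ⟨v₀, Finset.mem_univ _, Nat.pos_of_ne_zero hv₀⟩
  -- The pool is nonempty and omits a unit of `w`, so the low signals hold at least two units.
  have hclt : ∑ v, c v < ∑ v, ∑ s ∈ L, z.mass s v :=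
    Finset.sum_lt_sum (fun v _ => hc v) ⟨w, Finset.mem_univ _, hw⟩
  obtain ⟨s₁, h₁, s₂, h₂, hne⟩ := z.exists_pair_low hS L hL (by omega)
  set z' := z.regroup L c hc h₁ h₂ with hz'
  have hm₁ : ∀ v, z'.mass s₁ v = c v := fun v => by simp [hz', regroup, h₁, hne]
  have hm : ∀ s, s ∉ L → ∀ v, z'.mass s v = z.mass s v := fun s hs v => by
    simp [hz', regroup, hs]
  have hpm₁ : T ≤ z'.postMean s₁ := by
    have hcpos' : 0 < ∑ v, (c v : ℝ) := by exact_mod_cast hcpos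
    rw [postMean, condExp_eq hε]
    simp only [hm₁]
    rw [le_div_iff₀ hcpos']
    simp only [mul_sub, Finset.sum_sub_distrib, ← Finset.sum_mul] at hcT
    linarith
  have hout : ∀ s ∈ Lᶜ, H (z'.postMean s) * ∑ v : G.V, (z'.mass s v : ℝ) * u v =
      H (z.postMean s) * ∑ v : G.V, (z.mass s v : ℝ) * u v := by
    intro s hs
    simp only [postMean, condExp_eq hε, hm s (Finset.mem_compl.1 hs)]
  have h := hbest z'
  rw [← Finset.sum_add_sum_compl L, ← Finset.sum_add_sum_compl L (fun s => H (z.postMean s) * _),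
    Finset.sum_congr rfl hout] at h
  have h3 := Finset.single_le_sum (fun s _ => hterm z' s) h₁
  have h4 : α * ∑ v : G.V, (c v : ℝ) * u v ≤
      H (z'.postMean s₁) * ∑ v : G.V, (z'.mass s₁ v : ℝ) * u v := by
    simp only [hm₁]
    exact mul_le_mul_of_nonneg_right (hhigh _ hpm₁)
      (Finset.sum_nonneg fun v _ => mul_nonneg (Nat.cast_nonneg _) (hu0 v))
  linarith

/-- The excess over `T` is charged to winning mass: directly on signals of mean at least `T`, and
through the pooling deviation below. The term `α * T` pays for the unit that no longer fits into the
pool. -/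
lemma Scheme.sum_excess_le (hε : 0 < ε) (z : G.Scheme S i) {H : ℝ → ℝ} {T α : ℝ}
    (hT : 0 < T) (hα : 0 < α) (hH0 : ∀ e, 0 ≤ H e) (hlow : ∀ e, e < T → H e ≤ α)
    (hhigh : ∀ e, T ≤ e → α ≤ H e) (hS : ∑ v, G.t i v ≤ Fintype.card S)
    (hbest : ∀ z' : G.Scheme S i,
      ∑ s, H (z'.postMean s) * ∑ v : G.V, (z'.mass s v : ℝ) * G.u i v ≤
        ∑ s, H (z.postMean s) * ∑ v : G.V, (z.mass s v : ℝ) * G.u i v) :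
    α * ∑ v : G.V, (G.t i v : ℝ) * max (v - T) 0 ≤
      α * T + ∑ s, H (z.postMean s) * ∑ v : G.V, (z.mass s v : ℝ) * (v + T) := by
  classical
  have hV0 : ∀ v : G.V, (0 : ℝ) ≤ v := fun v => (G.V_subset v v.2).1
  have hu0 : ∀ v : G.V, 0 ≤ G.u i v := fun v => G.u_nonneg i v (G.V_subset v v.2)
  have hexc : ∀ v : G.V, max ((v : ℝ) - T) 0 ≤ v := fun v =>
    max_le (by linarith) (hV0 v)
  set L : Finset S := {s | z.postMean s < T} with hLdef
  set l : G.V → ℕ := fun v => ∑ s ∈ L, z.mass s v with hl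
  set R : G.V → ℝ := fun v => ∑ s ∈ L, H (z.postMean s) * z.mass s v with hRdef
  have hR0 : ∀ v, 0 ≤ R v := fun v =>
    Finset.sum_nonneg fun s _ => mul_nonneg (hH0 _) (Nat.cast_nonneg _)
  have hRl : ∀ v, R v ≤ α * l v := by
    intro v
    simp only [hRdef, hl, Nat.cast_sum, Finset.mul_sum]
    exact Finset.sum_le_sum fun s hs => mul_le_mul_of_nonneg_right
      (hlow _ (Finset.mem_filter.1 hs).2) (Nat.cast_nonneg _)
  have hL : ∀ s, s ∉ L → 1 ≤ ∑ v, z.mass s v := by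
    intro s hs
    by_contra h
    have h0 : ∑ v, z.mass s v = 0 := by omega
    have h0' : ∑ v, (z.mass s v : ℝ) = 0 := by exact_mod_cast h0
    refine hs (Finset.mem_filter.2 ⟨Finset.mem_univ _, ?_⟩)
    -- Unused labels have posterior mean `0 / 0 = 0 < T` and therefore count as low.
    rw [postMean, condExp_eq hε, h0', div_zero]
    exact hT
  have key : α * ∑ v : G.V, (l v : ℝ) * max (v - T) 0 ≤ α * T + ∑ v : G.V, R v * (v + T) := by
    have hRT : 0 ≤ ∑ v : G.V, R v * (v + T) :=
      Finset.sum_nonneg fun v _ => mul_nonneg (hR0 v) (by linarith [hV0 v])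
    by_cases hl0 : ∀ v, l v = 0
    · simp only [hl0, Nat.cast_zero, zero_mul, Finset.sum_const_zero, mul_zero]
      linarith [mul_pos hα hT]
    have hneg : ∑ v : G.V, (l v : ℝ) * (v - T) < 0 := by
      push Not at hl0
      obtain ⟨v, hv⟩ := hl0
      obtain ⟨s, hs, hsv⟩ := Finset.exists_ne_zero_of_sum_ne_zero hv
      have h1 : ∑ v : G.V, (l v : ℝ) * (v - T) =
          ∑ s ∈ L, ∑ v : G.V, (z.mass s v : ℝ) * (v - T) := by
        simp only [hl, Nat.cast_sum, Finset.sum_mul]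
        exact Finset.sum_comm
      have hnonzero : ∀ s, ∑ v, (z.mass s v : ℝ) = 0 → ∀ v, (z.mass s v : ℝ) = 0 := fun s h v =>
        (Finset.sum_eq_zero_iff_of_nonneg fun v _ => Nat.cast_nonneg _).1 h v (Finset.mem_univ v)
      rw [h1]
      refine Finset.sum_neg' (fun s hs => ?_) ⟨s, hs, ?_⟩
      · by_cases h : ∑ v, (z.mass s v : ℝ) = 0
        · simp [hnonzero s h]
        · exact (z.sum_mass_low hε h (Finset.mem_filter.1 hs).2).le
      · exact z.sum_mass_low hε (fun h => hsv (by exact_mod_cast hnonzero s h v))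
          (Finset.mem_filter.1 hs).2
    obtain ⟨c, w, hcl, hlt, hgt, hw, hcT, hcw⟩ := exists_prefix l hneg
    have hIC := z.pooled_le_of_best hε hH0 hhigh hS hu0 hbest L hL hcl hw hcT
    rcases prefix_dichotomy hlt hgt hR0 hRl hu0
      (fun v v' h => G.u_mono i (G.V_subset v v.2) (G.V_subset v' v'.2) h) hIC with h | ⟨h0, h⟩
    -- Values above `T` exceed `w`, so the pool contains them entirely; by maximality its total
    -- value is at most `T` times its size plus `T`.
    · have hwT : (w : ℝ) < T := by linarith
      have h1 : ∑ v : G.V, (l v : ℝ) * max (v - T) 0 ≤ ∑ v : G.V, (c v : ℝ) * v := by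
        refine Finset.sum_le_sum fun v _ => ?_
        rcases le_or_gt v w with hvw | hvw
        · have : (v : ℝ) ≤ w := hvw
          rw [max_eq_right (by linarith), mul_zero]
          exact mul_nonneg (Nat.cast_nonneg _) (hV0 v)
        · rw [hgt v hvw]
          exact mul_le_mul_of_nonneg_left (hexc v) (Nat.cast_nonneg _)
      have h2 : ∑ v : G.V, (c v : ℝ) * v ≤ T * ∑ v, (c v : ℝ) + T := by
        simp only [mul_sub, Finset.sum_sub_distrib, ← Finset.sum_mul] at hcw
        linarith [hV0 w]
      have h3 : T * ∑ v, R v ≤ ∑ v : G.V, R v * (v + T) := by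
        rw [Finset.mul_sum]
        exact Finset.sum_le_sum fun v _ => by nlinarith [mul_nonneg (hR0 v) (hV0 v)]
      calc α * ∑ v : G.V, (l v : ℝ) * max (v - T) 0 ≤ α * (T * ∑ v, (c v : ℝ) + T) :=
            mul_le_mul_of_nonneg_left (h1.trans h2) hα.le
        _ = T * (α * ∑ v, (c v : ℝ)) + α * T := by ring
        _ ≤ T * ∑ v, R v + α * T := by gcongr
        _ ≤ _ := by linarith
    -- Zero utility means `w = 0`, and all low mass at positive values already wins at the rate `α`.
    · have hpos : ∀ v : G.V, 0 < (v : ℝ) → 0 < G.u i v := fun v hv =>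
        G.u_pos i v ⟨hv, (G.V_subset v v.2).2⟩
      have hw0 : (w : ℝ) = 0 := by
        by_contra h
        exact (hpos w (lt_of_le_of_ne (hV0 w) (Ne.symm h))).ne' h0
      have h1 : ∀ v : G.V, α * ((l v : ℝ) * max ((v : ℝ) - T) 0) ≤ R v * (v + T) := by
        intro v
        rcases (hV0 v).eq_or_lt with hv | hv
        · rw [max_eq_right (by linarith), mul_zero, mul_zero]
          exact mul_nonneg (hR0 v) (by linarith)
        · have hwv : w < v := by
            rw [← Subtype.coe_lt_coe, hw0]; exact hv
          rw [← mul_assoc, ← h v hwv (hpos v hv)]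
          exact mul_le_mul_of_nonneg_left ((hexc v).trans (by linarith)) (hR0 v)
      rw [Finset.mul_sum]
      have := Finset.sum_le_sum fun v (_ : v ∈ Finset.univ) => h1 v
      linarith [mul_pos hα hT]
  have hhighsum : α * ∑ s ∈ Lᶜ, ∑ v : G.V, (z.mass s v : ℝ) * max (v - T) 0 ≤
      ∑ s ∈ Lᶜ, H (z.postMean s) * ∑ v : G.V, (z.mass s v : ℝ) * (v + T) := by
    rw [Finset.mul_sum]
    refine Finset.sum_le_sum fun s hs => ?_
    have hs : T ≤ z.postMean s := by
      rw [Finset.mem_compl, hLdef, Finset.mem_filter] at hs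
      exact not_lt.1 fun h => hs ⟨Finset.mem_univ _, h⟩
    refine mul_le_mul (hhigh _ hs) (Finset.sum_le_sum fun v _ => ?_)
      (Finset.sum_nonneg fun v _ => mul_nonneg (Nat.cast_nonneg _) (le_max_right _ _)) (hH0 _)
    exact mul_le_mul_of_nonneg_left ((hexc v).trans (by linarith)) (Nat.cast_nonneg _)
  have hsplit : ∑ v : G.V, (G.t i v : ℝ) * max (v - T) 0 =
      ∑ v : G.V, (l v : ℝ) * max (v - T) 0 +
        ∑ s ∈ Lᶜ, ∑ v : G.V, (z.mass s v : ℝ) * max (v - T) 0 := by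
    have h1 : ∑ v : G.V, (l v : ℝ) * max ((v : ℝ) - T) 0 =
        ∑ s ∈ L, ∑ v : G.V, (z.mass s v : ℝ) * max (v - T) 0 := by
      simp only [hl, Nat.cast_sum, Finset.sum_mul]
      exact Finset.sum_comm
    rw [h1, Finset.sum_add_sum_compl, Finset.sum_comm]
    refine Finset.sum_congr rfl fun v _ => ?_
    rw [← Finset.sum_mul, ← z.sum_mass v, Nat.cast_sum]
  have hRsum : ∑ v : G.V, R v * (v + T) =
      ∑ s ∈ L, H (z.postMean s) * ∑ v : G.V, (z.mass s v : ℝ) * (v + T) := by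
    simp only [hRdef, Finset.sum_mul, Finset.mul_sum]
    rw [Finset.sum_comm]
    simp only [mul_assoc]
  rw [hsplit, mul_add, ← Finset.sum_add_sum_compl L (fun s => H (z.postMean s) * _), ← hRsum]
  linarith

end Game

end Persuasion

/-! ### Equilibria -/

namespace Persuasion

namespace Game

variable {N k : ℕ} {ε : ℝ} {G : Game N ε} {S : Type*} [Fintype S]

instance (i : Fin N) [Nonempty S] : Nonempty (G.Scheme S i) := by
  classical
  exact ⟨⟨fun s v => if s = Classical.arbitrary S then G.t i v else 0, fun v => by simp⟩⟩

/-- The weights of a mixed profile. -/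
noncomputable def weights (x : G.MixedProfile S) (i : Fin N) : G.Scheme S i → ℝ := x i

lemma weights_update (x : G.MixedProfile S) (i : Fin N) (y : stdSimplex ℝ (G.Scheme S i)) :
    weights (Function.update x i y) = Function.update (weights x) i (y : G.Scheme S i → ℝ) := by
  funext j
  by_cases h : j = i
  · subst h; simp [weights]
  · simp [weights, h]

lemma weights_sum (x : G.MixedProfile S) (i : Fin N) : ∑ z, weights x i z = 1 := (x i).2.2

lemma weights_nonneg (x : G.MixedProfile S) (i : Fin N) (z : G.Scheme S i) : 0 ≤ weights x i z :=
  (x i).2.1 z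

theorem exists_isNash (hN : 0 < N) [Nonempty S] (k : ℕ) :
    ∃ x : G.MixedProfile S, IsNash k x := by
  have : Nonempty (Fin N) := ⟨⟨0, hN⟩⟩
  obtain ⟨x, hx, hnash⟩ := exists_mixed_nash fun i (Z : ∀ i, G.Scheme S i) => pureUtility k Z i
  refine ⟨fun i => ⟨x i, hx i⟩, fun i y => ?_⟩
  have h : utility k (Function.update (fun i => ⟨x i, hx i⟩ : G.MixedProfile S) i y) i =
      piExp (Function.update x i (y : G.Scheme S i → ℝ)) fun Z => pureUtility k Z i :=
    congrArg (fun p => piExp p fun Z => pureUtility k Z i) (weights_update _ i y)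
  rw [h, piExp_update x i (hx i).2]
  calc _ ≤ ∑ a, (y : G.Scheme S i → ℝ) a * piExp x fun Z => pureUtility k Z i :=
        Finset.sum_le_sum fun a _ => mul_le_mul_of_nonneg_left (hnash i a) (y.2.1 a)
    _ = utility k (fun i => ⟨x i, hx i⟩ : G.MixedProfile S) i := by
        have hy : ∑ a, (y : G.Scheme S i → ℝ) a = 1 := y.2.2
        rw [← Finset.sum_mul, hy, one_mul]
        rfl

/-! ### The joint law of schemes and signals -/

lemma Scheme.signalProb_nonneg (hε : 0 < ε) {i : Fin N} (z : G.Scheme S i) (s : S) :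
    0 ≤ z.signalProb s := by
  rw [signalProb_eq]
  exact mul_nonneg hε.le (Finset.sum_nonneg fun v _ => Nat.cast_nonneg _)

lemma Scheme.sum_signalProb {i : Fin N} (z : G.Scheme S i) : ∑ s, z.signalProb s = 1 := by
  simp only [signalProb_eq, ← Finset.mul_sum]
  rw [Finset.sum_comm, ← G.total_mass i, Finset.mul_sum]
  refine Finset.sum_congr rfl fun v _ => ?_
  rw [← z.sum_mass v, Nat.cast_sum, mul_comm]

lemma Scheme.postMean_nonneg (hε : 0 < ε) {i : Fin N} (z : G.Scheme S i) (s : S) :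
    0 ≤ z.postMean s := by
  rw [postMean, condExp_eq hε]
  exact div_nonneg (Finset.sum_nonneg fun v _ =>
    mul_nonneg (Nat.cast_nonneg _) (G.V_subset v v.2).1)
    (Finset.sum_nonneg fun v _ => Nat.cast_nonneg _)

/-- The joint weight of a scheme and a signal. -/
noncomputable def joint (p : ∀ i, G.Scheme S i → ℝ) (i : Fin N) (a : G.Scheme S i × S) : ℝ :=
  p i a.1 * a.1.signalProb a.2

lemma joint_update (p : ∀ i, G.Scheme S i → ℝ) (i : Fin N) (q : G.Scheme S i → ℝ) :
    joint (Function.update p i q) =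
      Function.update (joint p) i fun a => q a.1 * a.1.signalProb a.2 := by
  funext j
  by_cases h : j = i
  · subst h; funext a; simp [joint]
  · funext a; simp [joint, h]

lemma joint_sum (x : G.MixedProfile S) (i : Fin N) : ∑ a, joint (weights x) i a = 1 := by
  simp only [joint, Fintype.sum_prod_type, ← Finset.mul_sum, Scheme.sum_signalProb, mul_one]
  exact weights_sum x i

lemma joint_nonneg (hε : 0 < ε) (x : G.MixedProfile S) (i : Fin N) (a : G.Scheme S i × S) :
    0 ≤ joint (weights x) i a :=
  mul_nonneg (weights_nonneg x i _) (a.1.signalProb_nonneg hε _)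

/-- Mixing and signalling are independent across agents, so each pair of a scheme and its signal is
one coordinate of a product space. -/
lemma mixedExp_eq_piExp (x : G.MixedProfile S)
    (F : (∀ i, G.Scheme S i) → (Fin N → S) → ℝ) :
    mixedExp x (fun Z => ∑ s : Fin N → S, (∏ j, (Z j).signalProb (s j)) * F Z s) =
      piExp (joint (weights x)) fun ω => F (fun j => (ω j).1) (fun j => (ω j).2) := by
  let E : (∀ i, G.Scheme S i × S) ≃ (∀ i, G.Scheme S i) × (Fin N → S) :=
    { toFun := fun ω => (fun j => (ω j).1, fun j => (ω j).2)
      invFun := fun p j => (p.1 j, p.2 j)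
      left_inv := fun _ => rfl
      right_inv := fun _ => rfl }
  rw [piExp, Fintype.sum_equiv E _ (fun p => (∏ j, weights x j (p.1 j)) *
    ((∏ j, (p.1 j).signalProb (p.2 j)) * F p.1 p.2))]
  · rw [Fintype.sum_prod_type, mixedExp]
    refine Finset.sum_congr rfl fun Z _ => ?_
    dsimp only
    rw [← Finset.mul_sum]
    rfl
  · intro ω
    simp only [joint, Finset.prod_mul_distrib, E, Equiv.coe_fn_mk]
    ring

/-- The vector of posterior means. -/
noncomputable def means (ω : ∀ i, G.Scheme S i × S) (j : Fin N) : ℝ := (ω j).1.postMean (ω j).2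

lemma means_update (ω : ∀ i, G.Scheme S i × S) (i : Fin N) (a : G.Scheme S i × S) :
    means (Function.update ω i a) = Function.update (means ω) i (a.1.postMean a.2) := by
  funext j
  by_cases h : j = i
  · subst h; simp [means]
  · simp [means, h]

/-- The probability that agent `i` is selected with posterior mean `e`. -/
noncomputable def winProb (k : ℕ) (x : G.MixedProfile S) (i : Fin N) (e : ℝ) : ℝ :=
  piExp (joint (weights x)) fun ω => selectProb k (Function.update (means ω) i e) i

lemma piExp_update_selectProb (x : G.MixedProfile S) (i : Fin N)
    (q g : G.Scheme S i × S → ℝ) :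
    piExp (Function.update (joint (weights x)) i q)
      (fun ω => selectProb k (means ω) i * g (ω i)) =
      ∑ a, q a * (winProb k x i (a.1.postMean a.2) * g a) := by
  rw [piExp_update _ i (joint_sum x i)]
  simp only [means_update, Function.update_self, piExp_mul_const, winProb]

lemma sum_joint_winProb (hε : 0 < ε) (x : G.MixedProfile S) (i : Fin N) (q : G.Scheme S i → ℝ)
    (f : ℝ → ℝ) :
    ∑ a : G.Scheme S i × S, q a.1 * a.1.signalProb a.2 *
      (winProb k x i (a.1.postMean a.2) * a.1.condExp f a.2) =
      ε * ∑ z, q z * ∑ s, winProb k x i (z.postMean s) * ∑ v : G.V, (z.mass s v : ℝ) * f v := by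
  rw [Fintype.sum_prod_type, Finset.mul_sum]
  refine Finset.sum_congr rfl fun z _ => ?_
  rw [Finset.mul_sum, Finset.mul_sum]
  refine Finset.sum_congr rfl fun s _ => ?_
  calc _ = q z * winProb k x i (z.postMean s) * (z.signalProb s * z.condExp f s) := by ring
    _ = _ := by rw [z.signalProb_mul_condExp hε]; ring

/-- The opponents enter only through `winProb`, which makes the payoff linear in the agent's own
mixture. -/
lemma utility_update (hε : 0 < ε) (x : G.MixedProfile S) (i : Fin N)
    (y : stdSimplex ℝ (G.Scheme S i)) : utility k (Function.update x i y) i =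
      ε * ∑ z, (y : G.Scheme S i → ℝ) z *
        ∑ s, winProb k x i (z.postMean s) * ∑ v : G.V, (z.mass s v : ℝ) * G.u i v := by
  rw [← sum_joint_winProb hε, ← piExp_update_selectProb x i _
    (fun a => a.1.condExp (G.u i) a.2), ← joint_update, ← weights_update]
  exact mixedExp_eq_piExp _ fun Z s =>
    selectProb k (fun j => (Z j).postMean (s j)) i * (Z i).condExp (G.u i) (s i)

/-- No scheme beats the average payoff of the mixture, so every scheme of positive weight attains
it. -/
lemma IsNash.best_response (hε : 0 < ε) {x : G.MixedProfile S} (hx : IsNash k x) (i : Fin N)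
    {z : G.Scheme S i} (hz : 0 < weights x i z) (z' : G.Scheme S i) :
    ∑ s, winProb k x i (z'.postMean s) * ∑ v : G.V, (z'.mass s v : ℝ) * G.u i v ≤
      ∑ s, winProb k x i (z.postMean s) * ∑ v : G.V, (z.mass s v : ℝ) * G.u i v := by
  classical
  set B : G.Scheme S i → ℝ := fun z =>
    ∑ s, winProb k x i (z.postMean s) * ∑ v : G.V, (z.mass s v : ℝ) * G.u i v with hB
  have hself : utility k x i = ε * ∑ z, weights x i z * B z := by
    rw [← Function.update_eq_self i x, utility_update hε, Function.update_eq_self]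
    rfl
  have hle : ∀ z', B z' ≤ ∑ z, weights x i z * B z := by
    intro z'
    have h := hx i ⟨Pi.single z' 1, single_mem_stdSimplex ℝ z'⟩
    rw [utility_update hε, hself] at h
    calc B z' = ∑ z, (Pi.single z' 1 : G.Scheme S i → ℝ) z * B z := by simp [Pi.single_apply]
      _ ≤ _ := le_of_mul_le_mul_left h hε
  set M := ∑ z, weights x i z * B z with hM
  have h0 : ∑ z, weights x i z * (M - B z) = 0 := by
    simp only [mul_sub, Finset.sum_sub_distrib]
    rw [← Finset.sum_mul, weights_sum, one_mul, ← hM, sub_self]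
  have h1 := (Finset.sum_eq_zero_iff_of_nonneg fun z _ =>
    mul_nonneg (weights_nonneg x i z) (sub_nonneg.2 (hle z))).1 h0 z (Finset.mem_univ z)
  have h2 : M - B z = 0 := (mul_eq_zero.1 h1).resolve_left hz.ne'
  exact (hle z').trans_eq (sub_eq_zero.1 h2)

lemma welfare_eq_piExp (x : G.MixedProfile S) : welfare k x =
    piExp (joint (weights x)) fun ω => ∑ j ∈ Finset.Icc 1 k, ordered (means ω) j :=
  mixedExp_eq_piExp x fun Z s => ∑ j ∈ Finset.Icc 1 k, ordered (fun i => (Z i).postMean (s i)) j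

lemma piExp_selectProb (hε : 0 < ε) (x : G.MixedProfile S) (i : Fin N) (f : ℝ → ℝ) :
    (piExp (joint (weights x)) fun ω => selectProb k (means ω) i * (ω i).1.condExp f (ω i).2) =
      ε * ∑ z, weights x i z *
        ∑ s, winProb k x i (z.postMean s) * ∑ v : G.V, (z.mass s v : ℝ) * f v := by
  rw [← sum_joint_winProb hε, ← piExp_update_selectProb x i _ (fun a => a.1.condExp f a.2)]
  congr 1
  exact (Function.update_eq_self i (joint (weights x))).symm

lemma welfare_eq_sum (hε : 0 < ε) (hk : 1 ≤ k) (hkN : k ≤ N) (x : G.MixedProfile S) :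
    welfare k x = ∑ i, ε * ∑ z, weights x i z *
        ∑ s, winProb k x i (z.postMean s) * ∑ v : G.V, (z.mass s v : ℝ) * v := by
  rw [welfare_eq_piExp]
  simp only [← sum_selectProb_mul_self _ hk hkN]
  rw [piExp_sum]
  exact Finset.sum_congr rfl fun i _ => piExp_selectProb hε x i fun v => v

lemma sum_winProb (hk : 1 ≤ k) (hkN : k ≤ N) (x : G.MixedProfile S) :
    ∑ i, ε * ∑ z, weights x i z *
      ∑ s, winProb k x i (z.postMean s) * ∑ v : G.V, (z.mass s v : ℝ) = k := by
  calc _ = ∑ i, piExp (joint (weights x)) fun ω => selectProb k (means ω) i := by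
        refine Finset.sum_congr rfl fun i _ => ?_
        have h := piExp_update_selectProb (k := k) x i (joint (weights x) i) fun _ => 1
        rw [Function.update_eq_self] at h
        simp only [mul_one] at h
        rw [h, Fintype.sum_prod_type, Finset.mul_sum]
        refine Finset.sum_congr rfl fun z _ => ?_
        rw [Finset.mul_sum, Finset.mul_sum]
        refine Finset.sum_congr rfl fun s _ => ?_
        rw [joint, Scheme.signalProb_eq]
        ring
    _ = k := by
        rw [← piExp_sum]
        simp only [sum_selectProb _ hk hkN]
        exact piExp_const _ (joint_sum x) _

/-! ### Winning probabilities at a threshold and the welfare bound -/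

lemma winProb_nonneg (hε : 0 < ε) (hk : 1 ≤ k) (hkN : k ≤ N) (x : G.MixedProfile S) (i : Fin N)
    (e : ℝ) : 0 ≤ winProb k x i e := by
  rw [← piExp_const (joint (weights x)) (joint_sum x) 0]
  exact piExp_mono (joint_nonneg hε x) fun ω => selectProb_nonneg _ hk hkN i

open Classical in
/-- The probability that fewer than `k` competitors of `i` reach the posterior mean `T`. -/
noncomputable def passProb (k : ℕ) (x : G.MixedProfile S) (T : ℝ) (i : Fin N) : ℝ :=
  piExp (joint (weights x)) fun ω => if (rivals (means ω) T i).card < k then 1 else 0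

lemma rivals_update (e : Fin N → ℝ) (T : ℝ) (i : Fin N) (r : ℝ) :
    rivals (Function.update e i r) T i = rivals e T i := by
  ext j
  simp only [rivals, Finset.mem_filter, Finset.mem_univ, true_and]
  by_cases h : j = i
  · simp [h]
  · simp [h]

/-- The rivals do not depend on the agent's own signal, so the one number `passProb` separates her
winning probabilities below `T` from those at or above it. -/
lemma winProb_le_passProb (hε : 0 < ε) (hk : 1 ≤ k) (hkN : k ≤ N) (x : G.MixedProfile S)
    (i : Fin N) {e T : ℝ} (he : e < T) : winProb k x i e ≤ passProb k x T i := by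
  refine piExp_mono (joint_nonneg hε x) fun ω => ?_
  split_ifs with h
  · exact selectProb_le_one _ hk hkN i
  · refine (selectProb_eq_zero (T := T) hk hkN (by simpa using he) ?_).le
    rw [rivals_update]
    exact not_lt.1 h

lemma passProb_le_winProb (hε : 0 < ε) (hk : 1 ≤ k) (hkN : k ≤ N) (x : G.MixedProfile S)
    (i : Fin N) {e T : ℝ} (he : T ≤ e) : passProb k x T i ≤ winProb k x i e := by
  refine piExp_mono (joint_nonneg hε x) fun ω => ?_
  split_ifs with h
  · refine (selectProb_eq_one (T := T) hk hkN (by simpa using he) ?_).ge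
    rwa [rivals_update]
  · exact selectProb_nonneg _ hk hkN i

lemma sum_ordered_means_nonneg (hε : 0 < ε) (hk : 1 ≤ k) (hkN : k ≤ N)
    (ω : ∀ i, G.Scheme S i × S) : 0 ≤ ∑ j ∈ Finset.Icc 1 k, ordered (means ω) j := by
  rw [← sum_selectProb_mul_self _ hk hkN]
  exact Finset.sum_nonneg fun i _ =>
    mul_nonneg (selectProb_nonneg _ hk hkN i) (Scheme.postMean_nonneg hε _ _)

lemma welfare_nonneg (hε : 0 < ε) (hk : 1 ≤ k) (hkN : k ≤ N) (x : G.MixedProfile S) :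
    0 ≤ welfare k x := by
  rw [welfare_eq_piExp, ← piExp_const (joint (weights x)) (joint_sum x) 0]
  exact piExp_mono (joint_nonneg hε x) (sum_ordered_means_nonneg hε hk hkN)

/-- Markov's inequality: `k` rivals at `T` make the realized welfare at least `k * T`. -/
lemma mul_one_sub_passProb_le (hε : 0 < ε) (hk : 1 ≤ k) (hkN : k ≤ N) (x : G.MixedProfile S)
    (i : Fin N) (T : ℝ) : k * T * (1 - passProb k x T i) ≤ welfare k x := by
  classical
  have h := piExp_mono (joint_nonneg hε x)
    (f := fun ω => k * T + (if (rivals (means ω) T i).card < k then (1 : ℝ) else 0) * -(k * T))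
    (g := fun ω => ∑ j ∈ Finset.Icc 1 k, ordered (means ω) j) fun ω => by
      split_ifs with h
      · linarith [sum_ordered_means_nonneg hε hk hkN ω]
      · have := mul_le_sum_ordered hk hkN (not_lt.1 h)
        linarith
  rw [piExp_add, piExp_const _ (joint_sum x), piExp_mul_const, ← welfare_eq_piExp] at h
  have h2 : passProb k x T i = piExp (joint (weights x))
    fun ω => if (rivals (means ω) T i).card < k then (1 : ℝ) else 0 := by
      unfold passProb
      congr!
  rw [← h2] at h
  linarith

lemma IsNash.sum_excess_le (hε : 0 < ε) (hk : 1 ≤ k) (hkN : k ≤ N)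
    (hS : 1 / ε ≤ (Fintype.card S : ℝ)) {x : G.MixedProfile S} (hx : IsNash k x) {T : ℝ}
    (hT : 0 < T) (hTw : 2 * welfare k x ≤ k * T) :
    ∑ i, ∑ v : G.V, G.prior i v * max ((v : ℝ) - T) 0 ≤
      N * (ε * T) + 2 * (welfare k x + k * T) := by
  have hk0 : (0 : ℝ) < k := by exact_mod_cast hk
  have hSt : ∀ i, ∑ v, G.t i v ≤ Fintype.card S := by
    intro i
    have h := G.total_mass i
    rw [← Finset.sum_mul] at h
    rw [← eq_div_iff hε.ne'] at h
    rw [← h] at hS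
    exact_mod_cast hS
  set Q : ∀ i, G.Scheme S i → ℝ := fun i z =>
    ∑ s, winProb k x i (z.postMean s) * ∑ v : G.V, (z.mass s v : ℝ) * (v + T) with hQ
  have hQ0 : ∀ i z, 0 ≤ Q i z := fun i z => Finset.sum_nonneg fun s _ =>
    mul_nonneg (winProb_nonneg hε hk hkN x i _) (Finset.sum_nonneg fun v _ =>
      mul_nonneg (Nat.cast_nonneg _) (by linarith [(G.V_subset v v.2).1]))
  have hagent : ∀ i z, 0 < weights x i z →
      ∑ v : G.V, (G.t i v : ℝ) * max (v - T) 0 ≤ T + 2 * Q i z := by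
    intro i z hz
    -- As `k * T ≥ 2 * W`, at least `k` rivals reach `T` with probability at most one half.
    have hα : 1 / 2 ≤ passProb k x T i := by
      have h := mul_one_sub_passProb_le hε hk hkN x i T
      have h1 : k * T * (1 - passProb k x T i) ≤ k * T * (1 / 2) := by linarith
      have := le_of_mul_le_mul_left h1 (mul_pos hk0 hT)
      linarith
    have hα0 : 0 < passProb k x T i := by linarith
    have h := z.sum_excess_le hε hT hα0 (winProb_nonneg hε hk hkN x i)
      (fun e => winProb_le_passProb hε hk hkN x i) (fun e => passProb_le_winProb hε hk hkN x i)
      (hSt i) (hx.best_response hε i hz)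
    refine le_of_mul_le_mul_left (h.trans ?_) hα0
    nlinarith [mul_le_mul_of_nonneg_right hα (hQ0 i z)]
  have hmean : ∀ i, ∑ v : G.V, G.prior i v * max ((v : ℝ) - T) 0 ≤
      ε * T + 2 * (ε * ∑ z, weights x i z * Q i z) := by
    intro i
    have h1 : ∑ v : G.V, G.prior i v * max ((v : ℝ) - T) 0 =
        ε * ∑ z, weights x i z * ∑ v : G.V, (G.t i v : ℝ) * max (v - T) 0 := by
      rw [← Finset.sum_mul, weights_sum, one_mul, Finset.mul_sum]
      exact Finset.sum_congr rfl fun v _ => by rw [prior]; ring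
    have h2 : ∑ z, weights x i z * ∑ v : G.V, (G.t i v : ℝ) * max ((v : ℝ) - T) 0 ≤
        ∑ z, weights x i z * (T + 2 * Q i z) := by
      refine Finset.sum_le_sum fun z _ => ?_
      rcases (weights_nonneg x i z).eq_or_lt with h | h
      · rw [← h, zero_mul, zero_mul]
      · exact mul_le_mul_of_nonneg_left (hagent i z h) h.le
    have h3 : ∑ z, weights x i z * (T + 2 * Q i z) = T + 2 * ∑ z, weights x i z * Q i z := by
      simp only [mul_add, Finset.sum_add_distrib]
      rw [← Finset.sum_mul, weights_sum, one_mul, Finset.mul_sum]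
      congr 1
      exact Finset.sum_congr rfl fun z _ => by ring
    rw [h1]
    calc _ ≤ ε * (T + 2 * ∑ z, weights x i z * Q i z) :=
          mul_le_mul_of_nonneg_left (h2.trans_eq h3) hε.le
      _ = _ := by ring
  -- The value part of `Q` sums to the welfare; the constant part counts the `k` selected agents,
  -- each with `T`.
  have htotal : ∑ i, ε * ∑ z, weights x i z * Q i z = welfare k x + k * T := by
    have hkT := congrArg (· * T) (sum_winProb hk hkN x)
    rw [welfare_eq_sum hε hk hkN, ← hkT, Finset.sum_mul, ← Finset.sum_add_distrib]
    refine Finset.sum_congr rfl fun i _ => ?_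
    rw [mul_assoc, ← mul_add, Finset.sum_mul, ← Finset.sum_add_distrib]
    congr 1
    refine Finset.sum_congr rfl fun z _ => ?_
    rw [mul_assoc, ← mul_add, Finset.sum_mul, ← Finset.sum_add_distrib]
    congr 1
    refine Finset.sum_congr rfl fun s _ => ?_
    rw [mul_assoc, ← mul_add, Finset.sum_mul, ← Finset.sum_add_distrib]
    simp only [mul_add]
  calc _ ≤ ∑ i, (ε * T + 2 * (ε * ∑ z, weights x i z * Q i z)) :=
        Finset.sum_le_sum fun i _ => hmean i
    _ = N * (ε * T) + 2 * (welfare k x + k * T) := by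
        rw [Finset.sum_add_distrib,
          ← Finset.mul_sum _ (fun i => ε * ∑ z, weights x i z * Q i z), htotal]
        simp

lemma firstBest_le (hε : 0 < ε) (hkN : k ≤ N) {T : ℝ} :
    G.firstBest k ≤ k * T + ∑ i, ∑ v : G.V, G.prior i v * max ((v : ℝ) - T) 0 := by
  have hp0 : ∀ i v, 0 ≤ G.prior i v := fun i v => mul_nonneg (Nat.cast_nonneg _) hε.le
  have hp1 : ∀ i, ∑ v, G.prior i v = 1 := G.total_mass
  have : Nonempty {A : Finset (Fin N) // A.card = k} := by
    obtain ⟨A, -, hA⟩ := Finset.exists_subset_card_eq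
      (s := (Finset.univ : Finset (Fin N))) (n := k) (by simpa using hkN)
    exact ⟨⟨A, hA⟩⟩
  calc G.firstBest k ≤ piExp G.prior fun v : Fin N → G.V => k * T + ∑ i, max ((v i : ℝ) - T) 0 := by
        change piExp G.prior (fun v : Fin N → G.V =>
          ⨆ A : {A : Finset (Fin N) // A.card = k}, ∑ i ∈ A.1, (v i : ℝ)) ≤ _
        refine piExp_mono hp0 fun v => ciSup_le fun A => ?_
        calc ∑ i ∈ A.1, (v i : ℝ) ≤ ∑ i ∈ A.1, (T + max ((v i : ℝ) - T) 0) :=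
              Finset.sum_le_sum fun i _ => by linarith [le_max_left ((v i : ℝ) - T) 0]
          _ = k * T + ∑ i ∈ A.1, max ((v i : ℝ) - T) 0 := by
              rw [Finset.sum_add_distrib, Finset.sum_const, A.2, nsmul_eq_mul]
          _ ≤ _ := by
              refine add_le_add le_rfl ?_
              exact Finset.sum_le_sum_of_subset_of_nonneg (Finset.subset_univ _)
                fun i _ _ => le_max_right _ _
    _ = _ := by
        rw [piExp_add, piExp_const _ hp1, piExp_sum]
        congr 1
        exact Finset.sum_congr rfl fun i _ =>
          piExp_coord _ hp1 i fun v => max ((v : ℝ) - T) 0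

/-- In every equilibrium the welfare is within the factor `8 + 2 ε N` of the first best. -/
theorem IsNash.firstBest_le (hε : 0 < ε) (hk : 1 ≤ k) (hkN : k ≤ N)
    (hS : 1 / ε ≤ (Fintype.card S : ℝ)) {x : G.MixedProfile S} (hx : IsNash k x) :
    G.firstBest k ≤ (8 + 2 * (ε * N)) * welfare k x := by
  have hk1 : (1 : ℝ) ≤ k := by exact_mod_cast hk
  have hk0 : (0 : ℝ) < k := by linarith
  have hw := welfare_nonneg hε hk hkN x
  have hεN : 0 ≤ ε * N := mul_nonneg hε.le (Nat.cast_nonneg N)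
  refine le_of_forall_pos_le_add fun δ hδ => ?_
  -- The margin `η` keeps `T` positive when the welfare is zero; its total cost in the bound is `(3
  -- + ε * N) * η = δ`.
  set η := δ / (3 + ε * N) with hη
  have hη0 : 0 < η := div_pos hδ (by linarith)
  set T := (2 * welfare k x + η) / k with hTdef
  have hT : 0 < T := div_pos (by linarith) hk0
  have hkT : k * T = 2 * welfare k x + η := by rw [hTdef]; field_simp
  have hTle : T ≤ 2 * welfare k x + η := by
    rw [← hkT]
    exact le_mul_of_one_le_left hT.le hk1
  have h1 := hx.sum_excess_le hε hk hkN hS hT (by linarith)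
  have h2 := Game.firstBest_le (G := G) (k := k) hε hkN (T := T)
  have h3 : N * (ε * T) ≤ ε * N * (2 * welfare k x + η) := by
    calc N * (ε * T) = ε * N * T := by ring
      _ ≤ _ := mul_le_mul_of_nonneg_left hTle hεN
  have h4 : (3 + ε * N) * η = δ := by rw [hη]; field_simp
  linarith

end Game

end Persuasion

/-! ### The price of anarchy -/

theorem mainTheorem4 {N k : ℕ} {ε : ℝ} (hε : 0 < ε) (hk : 1 ≤ k) (hkN : k ≤ N)
    (hεN : 2.3766 * (ε * N) < 1)
    (G : Persuasion.Game N ε) (S : Type*) [Fintype S] (hS : 1 / ε ≤ (Fintype.card S : ℝ)) :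
    (∃ x : G.MixedProfile S, Persuasion.Game.IsNash k x) ∧
      G.PoA S k ≤ ENNReal.ofReal (22.459 / (1 - 2.3766 * (ε * N))) := by
  have hcard : (0 : ℝ) < Fintype.card S := (one_div_pos.2 hε).trans_le hS
  have : Nonempty S := Fintype.card_pos_iff.1 (by exact_mod_cast hcard)
  obtain ⟨x₀, hx₀⟩ := Persuasion.Game.exists_isNash (G := G) (S := S) (hk.trans hkN) k
  refine ⟨⟨x₀, hx₀⟩, ?_⟩
  have hεN0 : 0 ≤ ε * N := mul_nonneg hε.le (Nat.cast_nonneg N)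
  have hpos : 0 < 1 - 2.3766 * (ε * N) := by linarith
  set C := 22.459 / (1 - 2.3766 * (ε * N)) with hC
  -- The denominator of `C` is at most one and `ε * N < 1/2`, so the left side is below 9 and the
  -- right side at least 22.459.
  have hC9 : 8 + 2 * (ε * N) ≤ C := by
    have : (22.459 : ℝ) ≤ C := by
      rw [hC, le_div_iff₀ hpos]
      linarith
    linarith
  have hC0 : 0 < C := by linarith
  have : Nonempty {x : G.MixedProfile S // Persuasion.Game.IsNash k x} := ⟨⟨x₀, hx₀⟩⟩
  refine ENNReal.div_le_of_le_mul ?_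
  rw [ENNReal.mul_iInf_of_ne (ENNReal.ofReal_pos.2 hC0).ne' ENNReal.ofReal_ne_top]
  refine le_iInf fun x => ?_
  rw [← ENNReal.ofReal_mul hC0.le]
  exact ENNReal.ofReal_le_ofReal ((x.2.firstBest_le hε hk hkN hS).trans
    (mul_le_mul_of_nonneg_right hC9 (Persuasion.Game.welfare_nonneg hε hk hkN x.1)))
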